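/- Setting. Let $A$ be a finite set (the alphabet), $\mathbb{R}^A$ the free real vector space on $A$, and $W(A)$ the set of words over $A$, including the empty word $\mathbf 1$. Let $T(A)$ be the free real vector space on $W(A)$, with the deconcatenation coproduct $\nabla(a_1\cdots a_n)=\sum_{i=0}^n a_1\cdots a_i\otimes a_{i+1}\cdots a_n$. Let $[\,,]$ be a commutative and associative bilinear product on $\mathbb{R}^A$, and let $\omega\colon A\to\{1,2,\dots\}$ be a weight for it: if $V_i$ denotes the span of the letters $a$ with $\omega(a)=i$, then $[V_i,V_j]\subset V_{i+j}$ for all $i,j>0$. For a word put $\omega(a_1\cdots a_n)=\omega(a_1)+\cdots+\omega(a_n)$ and $\omega(\mathbf 1)=0$. The algebra $\hat T(A)$ is $T(A)$ with the quasi-shuffle product $\widehat{\sqcup\!\sqcup}$, the bilinear product with unit $\mathbf 1$ such that $$va\,\widehat{\sqcup\!\sqcup}\,wb=(v\,\widehat{\sqcup\!\sqcup}\,wb)\,a+(va\,\widehat{\sqcup\!\sqcup}\,w)\,b+(v\,\widehat{\sqcup\!\sqcup}\,w)\,[a,b]$$ for all words $v,w$ and letters $a,b$. Let $T^N_\omega(A)\subset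 T(A)$ be the span of the words of weight at most $N$. On $T(A)^*$ and on $T^N_\omega(A)^*$ the convolution product is $\langle\alpha*\beta,h\rangle=\langle\alpha\otimes\beta,\nabla h\rangle$. Let $0<\gamma<1$, $T>0$ and $N_\gamma=\lfloor\gamma^{-1}\rfloor$. A $\gamma$-quasi-geometric rough path is a map $X\colon[0,T]^2\to T^{N_\gamma}_\omega(A)^*$ with $\langle X_{st},\mathbf 1\rangle=1$ such that, for all $s,u,t\in[0,T]$: 1. $\langle X_{st},x\,\widehat{\sqcup\!\sqcup}\,y\rangle=\langle X_{st},x\rangle\langle X_{st},y\rangle$ for all $x,y\in T^{N_\gamma}_\omega(A)$ with $x\,\widehat{\sqcup\!\sqcup}\,y\in T^{N_\gamma}_\omega(A)$; 2. $X_{su}*X_{ut}=X_{st}$ (Chen's identity); 3. $\sup_{s\ne t}|\langle X_{st},w\rangle|/|t-s|^{\gamma\omega(w)}<\infty$ for every word $w$ with $\omega(w)\le N_\gamma$. It is over a path $x=(x^a)_{a\in A}\colon[0,T]\to\mathbb{R}^A$ if $\langle X_{st},a\rangle=x^a_t-x^a_s$ for all $s,t\in[0,T]$ and every letter $a$ with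 $\omega(a)\le N_\gamma$. Proposition. (Lyons' extension theorem) For every $\gamma$-quasi-geometric rough path $X$ there is a unique map $\mathbb{X}\colon[0,T]^2\to\hat T(A)^*$ such that each $\mathbb{X}_{st}$ restricts to $X_{st}$ on $T^{N_\gamma}_\omega(A)$, each $\mathbb{X}_{st}$ is multiplicative for $\widehat{\sqcup\!\sqcup}$ on all of $\hat T(A)$, $\mathbb{X}_{su}*\mathbb{X}_{ut}=\mathbb{X}_{st}$ for all $s,u,t\in[0,T]$, and $\sup_{s\ne t}|\langle\mathbb{X}_{st},w\rangle|/|t-s|^{\gamma\omega(w)}<\infty$ for every word $w$. (Lyons–Victoir extension) Suppose that $\gamma\,\omega(w)\neq 1$ for every word $w\in W(A)$. Then for every path $x=(x^a)_{a\in A}\colon[0,T]\to\mathbb{R}^A$ with $$\sup_{a\in A}\,\sup_{s\neq t}\frac{|x^a_t-x^a_s|}{|t-s|^{\gamma\omega(a)}}<\infty$$ there exists a $\gamma$-quasi-geometric rough path over $x$. -/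

import Mathlib

noncomputable section

namespace QuasiGeom

/-! ### Words, the quasi-shuffle product, and deconcatenation -/

/-- `T(A)`: the free real vector space on the words over `A`
(the list `[a₁, …, aₙ]` is the word `a₁ ⋯ aₙ`, the empty list is the empty word `𝟏`). -/
abbrev Tensor (A : Type*) : Type _ := List A →₀ ℝ

/-- A word, as a basis vector of `T(A)`. -/
abbrev word {A : Type*} (w : List A) : Tensor A := Finsupp.single w 1

/-- A letter, as a basis vector of `ℝ^A`, the free real vector space on `A`. -/
abbrev letter {A : Type*} (a : A) : A →₀ ℝ := Finsupp.single a 1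

/-- A commutative bracket: a commutative and associative bilinear product on `ℝ^A`. -/
structure CommBracket (A : Type*) where
  /-- the bilinear map -/
  br : (A →₀ ℝ) →ₗ[ℝ] (A →₀ ℝ) →ₗ[ℝ] (A →₀ ℝ)
  comm : ∀ x y, br x y = br y x
  assoc : ∀ x y z, br (br x y) z = br x (br y z)

/-- The bilinear map `T(A) × ℝ^A → T(A)`, `(w, a) ↦ wa`, appending a letter on the right. -/
def snoc {A : Type*} : Tensor A →ₗ[ℝ] (A →₀ ℝ) →ₗ[ℝ] Tensor A :=
  Finsupp.linearCombination ℝ fun w =>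
    Finsupp.linearCombination ℝ fun a => word (w ++ [a])

/-- The quasi-shuffle product of two words which are read from right to left: the recursion of the
quasi-shuffle product removes the last letters, which are the heads of the reversed words. -/
def quasiShuffleRev {A : Type*} (B : CommBracket A) : List A → List A → Tensor A
  | [], w => word w.reverse
  | a :: v, [] => word (a :: v).reverse
  | a :: v, b :: w =>
      snoc (quasiShuffleRev B v (b :: w)) (letter a)
        + snoc (quasiShuffleRev B (a :: v) w) (letter b)
        + snoc (quasiShuffleRev B v w) (B.br (letter a) (letter b))
  termination_by v w => v.length + w.length

/-- The quasi-shuffle product of two words. -/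
def quasiShuffleWord {A : Type*} (B : CommBracket A) (v w : List A) : Tensor A :=
  quasiShuffleRev B v.reverse w.reverse

/-- The quasi-shuffle product, the bilinear product of the algebra `T̂(A)`. -/
def quasiShuffle {A : Type*} (B : CommBracket A) : Tensor A →ₗ[ℝ] Tensor A →ₗ[ℝ] Tensor A :=
  Finsupp.linearCombination ℝ fun v =>
    Finsupp.linearCombination ℝ fun w => quasiShuffleWord B v w

/-- The deconcatenation coproduct `∇ (a₁ ⋯ aₙ) = ∑_{i = 0}^n a₁ ⋯ aᵢ ⊗ aᵢ₊₁ ⋯ aₙ`. -/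
def deconcatenation {A : Type*} : Tensor A →ₗ[ℝ] TensorProduct ℝ (Tensor A) (Tensor A) :=
  Finsupp.linearCombination ℝ fun w =>
    ∑ i ∈ Finset.range (w.length + 1), TensorProduct.tmul ℝ (word (w.take i)) (word (w.drop i))

/-- The convolution product `⟨α * β, h⟩ = ⟨α ⊗ β, ∇ h⟩` on the algebraic dual of `T(A)`. -/
def conv {A : Type*} (α β : Module.Dual ℝ (Tensor A)) : Module.Dual ℝ (Tensor A) :=
  LinearMap.mul' ℝ ℝ ∘ₗ TensorProduct.map α β ∘ₗ deconcatenation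

/-! ### Weights and truncation -/

/-- The homogeneous component `V_i` of `ℝ^A`, spanned by the letters of weight `i`. -/
def letterSpace {A : Type*} (ω : A → ℕ) (i : ℕ) : Submodule ℝ (A →₀ ℝ) :=
  Submodule.span ℝ (letter '' {a | ω a = i})

/-- `ω` is an intrinsic weight for the bracket: letters have positive weights, and the resulting
decomposition `ℝ^A = ⨁_{i > 0} V_i` satisfies `[V_i, V_j] ⊆ V_{i+j}`. -/
structure IsIntrinsicWeight {A : Type*} (B : CommBracket A) (ω : A → ℕ) : Prop where
  pos : ∀ a, 0 < ω a
  graded : ∀ i j, 0 < i → 0 < j → ∀ x ∈ letterSpace ω i, ∀ y ∈ letterSpace ω j,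
    B.br x y ∈ letterSpace ω (i + j)

/-- The weight of a word, the sum of the weights of its letters. -/
def wordWeight {A : Type*} (ω : A → ℕ) (w : List A) : ℕ := (w.map ω).sum

/-- The subspace `T_ω^N(A)` of `T(A)` spanned by the words of weight at most `N`. -/
abbrev truncSpace {A : Type*} (ω : A → ℕ) (N : ℕ) : Submodule ℝ (Tensor A) :=
  Finsupp.supported ℝ ℝ {w | wordWeight ω w ≤ N}

theorem word_mem_truncSpace {A : Type*} {ω : A → ℕ} {N : ℕ} {w : List A}
    (hw : wordWeight ω w ≤ N) : word w ∈ truncSpace ω N :=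
  Finsupp.single_mem_supported ℝ 1 hw

/-- A word of weight at most `N`, as an element of `T_ω^N(A)`. -/
def truncWord {A : Type*} {ω : A → ℕ} {N : ℕ} (w : List A) (hw : wordWeight ω w ≤ N) :
    truncSpace ω N :=
  ⟨word w, word_mem_truncSpace hw⟩

/-- The projection of `T(A)` onto `T_ω^N(A)` which kills the words of weight larger than `N`. -/
def truncProj {A : Type*} (ω : A → ℕ) (N : ℕ) : Tensor A →ₗ[ℝ] truncSpace ω N :=
  Finsupp.restrictDom ℝ ℝ {w | wordWeight ω w ≤ N}

/-- The convolution product on the dual of the subcoalgebra `T_ω^N(A)`. Since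
`∇ T_ω^N(A) ⊆ T_ω^N(A) ⊗ T_ω^N(A)`, it does not matter how the two functionals are extended to
`T(A)` before they are convolved; see `truncConv_truncWord` for the values on words. -/
def truncConv {A : Type*} {ω : A → ℕ} {N : ℕ} (α β : Module.Dual ℝ (truncSpace ω N)) :
    Module.Dual ℝ (truncSpace ω N) :=
  conv (α ∘ₗ truncProj ω N) (β ∘ₗ truncProj ω N) ∘ₗ (truncSpace ω N).subtype

/-! ### Quasi-geometric rough paths -/

/-- `N_γ = ⌊γ⁻¹⌋`. -/
def level (γ : ℝ) : ℕ := ⌊γ⁻¹⌋₊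

/-- `X : [0,T]² → (T_ω^{N_γ}(A))^*` is a `γ`-quasi-geometric rough path: a `γ`-weighted rough path
over `T̂(A)` with respect to the weight `ω`. -/
structure IsQuasiGeometricRoughPath {A : Type*} (B : CommBracket A) (ω : A → ℕ) (γ T : ℝ)
    (X : Set.Icc 0 T → Set.Icc 0 T → Module.Dual ℝ (truncSpace ω (level γ))) : Prop where
  /-- The truncated characters `X_{st}` are not zero. -/
  unit : ∀ s t, X s t (truncWord [] (Nat.zero_le _)) = 1
  mul : ∀ s t, ∀ x y : truncSpace ω (level γ),
    ∀ h : quasiShuffle B (x : Tensor A) (y : Tensor A) ∈ truncSpace ω (level γ),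
      X s t ⟨quasiShuffle B (x : Tensor A) (y : Tensor A), h⟩ = X s t x * X s t y
  chen : ∀ s u t, truncConv (X s u) (X u t) = X s t
  holder : ∀ (w : List A) (hw : wordWeight ω w ≤ level γ), ∃ C : ℝ, ∀ s t, s ≠ t →
    |X s t (truncWord w hw)| ≤ C * |(t : ℝ) - (s : ℝ)| ^ (γ * (wordWeight ω w : ℝ))

/-- `X` is over the path `x : [0,T] → ℝ^A`: its values at the words of length one which lie
in `T_ω^{N_γ}(A)` are the increments of `x`. -/
def IsOver {A : Type*} {ω : A → ℕ} {γ T : ℝ}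
    (X : Set.Icc 0 T → Set.Icc 0 T → Module.Dual ℝ (truncSpace ω (level γ)))
    (x : Set.Icc 0 T → A → ℝ) : Prop :=
  ∀ (a : A) (ha : wordWeight ω [a] ≤ level γ), ∀ s t, X s t (truncWord [a] ha) = x t a - x s a

/-- `XX : [0,T]² → (T̂(A))^*` extends `X` and is multiplicative, satisfies Chen's identity and has
the weighted Hölder bounds over all of `T̂(A)`. -/
structure IsLyonsExtension {A : Type*} (B : CommBracket A) (ω : A → ℕ) (γ T : ℝ)
    (X : Set.Icc 0 T → Set.Icc 0 T → Module.Dual ℝ (truncSpace ω (level γ)))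
    (XX : Set.Icc 0 T → Set.Icc 0 T → Module.Dual ℝ (Tensor A)) : Prop where
  extends_ : ∀ s t, XX s t ∘ₗ (truncSpace ω (level γ)).subtype = X s t
  mul : ∀ s t, ∀ x y : Tensor A, XX s t (quasiShuffle B x y) = XX s t x * XX s t y
  chen : ∀ s u t, conv (XX s u) (XX u t) = XX s t
  holder : ∀ w : List A, ∃ C : ℝ, ∀ s t, s ≠ t →
    |XX s t (word w)| ≤ C * |(t : ℝ) - (s : ℝ)| ^ (γ * (wordWeight ω w : ℝ))

/-! ### The defining identities on words -/

theorem snoc_word_letter {A : Type*} (w : List A) (a : A) :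
    snoc (word w) (letter a) = word (w ++ [a]) := by
  simp [snoc]

theorem quasiShuffle_word_word {A : Type*} (B : CommBracket A) (v w : List A) :
    quasiShuffle B (word v) (word w) = quasiShuffleWord B v w := by
  simp [quasiShuffle]

theorem quasiShuffle_nil_left {A : Type*} (B : CommBracket A) (w : List A) :
    quasiShuffle B (word []) (word w) = word w := by
  rw [quasiShuffle_word_word, quasiShuffleWord, List.reverse_nil, quasiShuffleRev,
    List.reverse_reverse]

theorem quasiShuffle_nil_right {A : Type*} (B : CommBracket A) (w : List A) :
    quasiShuffle B (word w) (word []) = word w := by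
  rw [quasiShuffle_word_word, quasiShuffleWord, List.reverse_nil]
  rcases h : w.reverse with _ | ⟨a, v⟩
  · rw [quasiShuffleRev, ← h, List.reverse_reverse]
  · rw [quasiShuffleRev, ← h, List.reverse_reverse]

theorem quasiShuffle_append_append {A : Type*} (B : CommBracket A) (v w : List A) (a b : A) :
    quasiShuffle B (word (v ++ [a])) (word (w ++ [b])) =
      snoc (quasiShuffle B (word v) (word (w ++ [b]))) (letter a)
        + snoc (quasiShuffle B (word (v ++ [a])) (word w)) (letter b)
        + snoc (quasiShuffle B (word v) (word w)) (B.br (letter a) (letter b)) := by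
  simp only [quasiShuffle_word_word, quasiShuffleWord, List.reverse_append, List.reverse_cons,
    List.reverse_nil, List.nil_append, List.cons_append]
  rw [quasiShuffleRev]

theorem conv_word {A : Type*} (α β : Module.Dual ℝ (Tensor A)) (w : List A) :
    conv α β (word w) =
      ∑ i ∈ Finset.range (w.length + 1), α (word (w.take i)) * β (word (w.drop i)) := by
  simp [conv, deconcatenation]

theorem wordWeight_take_add_drop {A : Type*} (ω : A → ℕ) (w : List A) (i : ℕ) :
    wordWeight ω (w.take i) + wordWeight ω (w.drop i) = wordWeight ω w := by
  unfold wordWeight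
  rw [← List.sum_append, ← List.map_append, List.take_append_drop]

theorem truncProj_word {A : Type*} {ω : A → ℕ} {N : ℕ} (w : List A) (hw : wordWeight ω w ≤ N) :
    truncProj ω N (word w) = truncWord w hw := by
  apply Subtype.ext
  rw [truncProj, Finsupp.restrictDom_apply]
  exact Finsupp.filter_single_of_pos _ hw

theorem truncConv_truncWord {A : Type*} {ω : A → ℕ} {N : ℕ}
    (α β : Module.Dual ℝ (truncSpace ω N)) (w : List A) (hw : wordWeight ω w ≤ N) :
    truncConv α β (truncWord w hw) =
      ∑ i ∈ Finset.range (w.length + 1),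
        α (truncWord (w.take i)
            ((Nat.le_of_add_right_le (wordWeight_take_add_drop ω w i).le).trans hw))
          * β (truncWord (w.drop i)
            ((Nat.le_of_add_left_le (wordWeight_take_add_drop ω w i).le).trans hw)) := by
  change conv _ _ (word w) = _
  rw [conv_word]
  refine Finset.sum_congr rfl fun i _ => ?_
  rw [LinearMap.comp_apply, LinearMap.comp_apply, truncProj_word, truncProj_word]

end QuasiGeom

end

open QuasiGeom

/-!
Both parts rest on one extension step: a rough path known on the words of weight at most `n`
extends to the words of weight `n + 1`, with prescribed increments at letters, as soon as
`γ (n + 1) ≠ 1` (`IsPartialRoughPath.exists_succ`). Iterating the step from `n = ⌊γ⁻¹⌋` gives the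
existence of the Lyons extension, and iterating it from `n = 0` gives a rough path over a given
path. Uniqueness of the Lyons extension holds because the difference of two extensions at a word of
minimal weight is additive in time and of order larger than one (`eq_zero_of_additive`).

The step has an algebraic and an analytic half.

* A character `g` of the graded bialgebra `T̂(A)` is determined by its logarithmic derivative `λ`,
  defined by `|w| g(w) = (g * λ)(w)`, and `g` is multiplicative up to some weight exactly if `λ`
  vanishes at products up to this weight. This only uses that deconcatenation is multiplicative
  for the quasi-shuffle product (`conv_quasiShuffle`). Hence each `X_{st}` extends to weight
  `n + 1`, where `λ` may be any functional that vanishes at products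
  (`IsTruncatedCharacter.dynkinExtension`). The functionals
  `a₁ ⋯ aₖ ↦ (-1)^(k-1) ω(aₖ) f([a₁, …, aₖ])` vanish at products and have arbitrary values at
  letters (`letterFunctional_quasiShuffle`), which adjusts the increments at letters.
* The extended family `Y` has the right Hölder bounds but need not satisfy Chen's identity. Its
  defect `Y_{su} * Y_{ut} - Y_{st}` is, at weight `n + 1`, a cocycle of order `γ (n + 1)` with
  values in a finite-dimensional space of functionals which vanish at products and letters. The
  sewing lemma (`exists_sewing`) writes it as a coboundary of the same order, which corrects `Y`.

The sewing lemma holds for every positive exponent `θ ≠ 1`: given `A` with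
`A_{st} - A_{su} - A_{ut} = O(|t - s|^θ)` there is `J` with `J_t - J_s - A_{st} = O(|t - s|^θ)`.
On the dyadic points, `J` is given by Riemann sums if `θ > 1`. If `θ < 1`, it is refined from level
to level by sharing the error of each interval equally between its halves, and the errors stay of
the right order since `1/2 < 2^(-θ)`. A chaining argument carries the bound from dyadic intervals
to all intervals, and a limit along an ultrafilter removes the finite resolution.
-/

noncomputable section

namespace QuasiGeom

/-! ### The sewing lemma for exponents different from one -/

section Sewing

variable {E : Type*} [NormedAddCommGroup E]

/-- `A : [0,1]² → E` is additive on ordered triples up to an error `C * (t - s) ^ θ`. -/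
def AlmostAdditive (A : ℝ → ℝ → E) (C θ : ℝ) : Prop :=
  ∀ s u t, 0 ≤ s → s ≤ u → u ≤ t → t ≤ 1 → ‖A s t - A s u - A u t‖ ≤ C * (t - s) ^ θ

theorem two_inv_pow_rpow (θ : ℝ) (m : ℕ) :
    ((1 : ℝ) / 2 ^ m) ^ θ = ((1 / 2 : ℝ) ^ θ) ^ m := by
  rw [← one_div_pow, ← Real.rpow_natCast, ← Real.rpow_natCast, ← Real.rpow_mul (by norm_num),
    ← Real.rpow_mul (by norm_num), mul_comm]

theorem AlmostAdditive.nonneg {A : ℝ → ℝ → E} {C θ : ℝ} (hA : AlmostAdditive A C θ) : 0 ≤ C := by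
  simpa using (norm_nonneg _).trans (hA 0 0 1 le_rfl le_rfl zero_le_one le_rfl)

theorem AlmostAdditive.norm_le {A : ℝ → ℝ → E} {C θ : ℝ} (hA : AlmostAdditive A C θ)
    (hθ : 0 < θ) {s u t d : ℝ} (hs : 0 ≤ s) (hsu : s ≤ u) (hut : u ≤ t) (ht : t ≤ 1)
    (hd : t - s ≤ d) : ‖A s t - A s u - A u t‖ ≤ C * d ^ θ :=
  (hA s u t hs hsu hut ht).trans <| mul_le_mul_of_nonneg_left
    (Real.rpow_le_rpow (by linarith) hd hθ.le) hA.nonneg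

/-- The increment of a grid function over a dyadic interval of level `m`, minus the value of `A`
there. -/
def gridError (A : ℝ → ℝ → E) (j : ℕ → ℕ → E) (m i : ℕ) : E :=
  j m (i + 1) - j m i - A (i / 2 ^ m) ((i + 1 : ℕ) / 2 ^ m)

/-- `j m i` stands for the value at `i / 2 ^ m` of a function on the dyadic points of level at most
`M`, whose increments over dyadic intervals of level `m` are those of `A` up to `K * ρ ^ m`. -/
structure IsGridSewing (A : ℝ → ℝ → E) (K ρ : ℝ) (M : ℕ) (j : ℕ → ℕ → E) : Prop where
  consistent : ∀ m i, m < M → j (m + 1) (2 * i) = j m i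
  bound : ∀ m i, m ≤ M → i < 2 ^ m → ‖gridError A j m i‖ ≤ K * ρ ^ m

/-- The failure of additivity of `A` at the midpoint of a dyadic interval. -/
def midpointDefect (A : ℝ → ℝ → E) (m i : ℕ) : E :=
  A (i / 2 ^ m) ((i + 1 : ℕ) / 2 ^ m)
    - A ((2 * i : ℕ) / 2 ^ (m + 1)) ((2 * i + 1 : ℕ) / 2 ^ (m + 1))
    - A ((2 * i + 1 : ℕ) / 2 ^ (m + 1)) ((2 * i + 1 + 1 : ℕ) / 2 ^ (m + 1))

theorem AlmostAdditive.norm_midpointDefect_le {A : ℝ → ℝ → E} {C θ : ℝ}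
    (hA : AlmostAdditive A C θ) (hθ : 0 < θ) {m i : ℕ} (hi : i < 2 ^ m) :
    ‖midpointDefect A m i‖ ≤ C * ((1 / 2 : ℝ) ^ θ) ^ m := by
  have h2 : (0 : ℝ) < 2 ^ m := by positivity
  have e1 : ((2 * i : ℕ) : ℝ) / 2 ^ (m + 1) = i / 2 ^ m := by
    push_cast; rw [pow_succ]; field_simp
  have e2 : ((2 * i + 1 + 1 : ℕ) : ℝ) / 2 ^ (m + 1) = (i + 1 : ℕ) / 2 ^ m := by
    push_cast; rw [pow_succ]; field_simp; ring
  have hi' : ((i + 1 : ℕ) : ℝ) ≤ 2 ^ m := by exact_mod_cast hi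
  rw [midpointDefect, e1, e2, ← two_inv_pow_rpow]
  refine hA.norm_le hθ (by positivity) ?_ ?_ (by rwa [div_le_one h2]) ?_
  · rw [← e1]; gcongr; omega
  · rw [← e2]; gcongr; omega
  · rw [← sub_div]; push_cast; simp

theorem gridError_eq_add {A : ℝ → ℝ → E} {j : ℕ → ℕ → E} {m : ℕ}
    (hj : ∀ i, j (m + 1) (2 * i) = j m i) (i : ℕ) :
    gridError A j m i = gridError A j (m + 1) (2 * i) + gridError A j (m + 1) (2 * i + 1)
      - midpointDefect A m i := by
  have h := hj (i + 1)
  rw [mul_add, mul_one] at h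
  simp only [gridError, midpointDefect, ← hj i, ← h]
  abel

/-- For `ρ < 1/2` (an exponent larger than one), the Riemann sums at the finest level are close to
`A` at all coarser levels. -/
theorem exists_isGridSewing_of_lt {A : ℝ → ℝ → E} {C θ : ℝ} (hA : AlmostAdditive A C θ)
    (hθ : 0 < θ) (hρ : (1 / 2 : ℝ) ^ θ < 1 / 2) (M : ℕ) :
    ∃ j, IsGridSewing A (C / (1 - 2 * (1 / 2 : ℝ) ^ θ)) ((1 / 2 : ℝ) ^ θ) M j := by
  set ρ : ℝ := (1 / 2 : ℝ) ^ θ with hρd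
  have hρ0 : 0 < ρ := by positivity
  have hC := hA.nonneg
  set K : ℝ := C / (1 - 2 * ρ) with hK
  have hK' : K * (1 - 2 * ρ) = C := div_mul_cancel₀ _ (by linarith)
  have hK0 : 0 ≤ K := div_nonneg hC (by linarith)
  set j : ℕ → ℕ → E := fun m i => ∑ k ∈ Finset.range (i * 2 ^ (M - m)),
    A (k / 2 ^ M) ((k + 1 : ℕ) / 2 ^ M) with hj
  have hcons : ∀ m i, m < M → j (m + 1) (2 * i) = j m i := by
    intro m i hm
    have : 2 * i * 2 ^ (M - (m + 1)) = i * 2 ^ (M - m) := by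
      rw [show M - m = M - (m + 1) + 1 by omega, pow_succ]; ring
    simp only [hj, this]
  refine ⟨j, hcons, ?_⟩
  have key : ∀ d m i, m + d = M → i < 2 ^ m → ‖gridError A j m i‖ ≤ K * ρ ^ m := by
    intro d
    induction d with
    | zero =>
      intro m i hm hi
      obtain rfl : m = M := hm
      simp only [gridError, hj, Nat.sub_self, pow_zero, mul_one, Finset.sum_range_succ]
      simp only [add_sub_cancel_left, sub_self, norm_zero]
      positivity
    | succ d ih =>
      intro m i hm hi
      rw [gridError_eq_add (fun i => hcons m i (by omega))]
      refine (norm_sub_le _ _).trans ((add_le_add (norm_add_le _ _) le_rfl).trans ?_)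
      have h1 := ih (m + 1) (2 * i) (by omega) (by rw [pow_succ]; omega)
      have h2 := ih (m + 1) (2 * i + 1) (by omega) (by rw [pow_succ]; omega)
      have h3 := hA.norm_midpointDefect_le hθ hi
      calc _ ≤ K * ρ ^ (m + 1) + K * ρ ^ (m + 1) + C * ρ ^ m := by gcongr
        _ = K * ρ ^ m := by rw [← hK']; ring
  intro m i hm hi
  exact key (M - m) m i (by omega) hi

variable [NormedSpace ℝ E]

/-- A grid function which is refined from one dyadic level to the next by choosing its value at
each midpoint such that the error of the coarse interval is shared equally by its two halves. -/
def equalErrorGrid (A : ℝ → ℝ → E) : ℕ → ℕ → E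
  | 0, i => if i = 0 then 0 else A 0 1
  | m + 1, l =>
    if l % 2 = 0 then equalErrorGrid A m (l / 2)
    else equalErrorGrid A m (l / 2) + (1 / 2 : ℝ) •
      (equalErrorGrid A m (l / 2 + 1) - equalErrorGrid A m (l / 2)
        + A ((2 * (l / 2) : ℕ) / 2 ^ (m + 1)) ((2 * (l / 2) + 1 : ℕ) / 2 ^ (m + 1))
        - A ((2 * (l / 2) + 1 : ℕ) / 2 ^ (m + 1)) ((2 * (l / 2) + 1 + 1 : ℕ) / 2 ^ (m + 1)))

theorem equalErrorGrid_two_mul (A : ℝ → ℝ → E) (m i : ℕ) :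
    equalErrorGrid A (m + 1) (2 * i) = equalErrorGrid A m i := by
  rw [equalErrorGrid]; simp

theorem equalErrorGrid_two_mul_add_one (A : ℝ → ℝ → E) (m i : ℕ) :
    equalErrorGrid A (m + 1) (2 * i + 1) = equalErrorGrid A m i + (1 / 2 : ℝ) •
      (equalErrorGrid A m (i + 1) - equalErrorGrid A m i
        + A ((2 * i : ℕ) / 2 ^ (m + 1)) ((2 * i + 1 : ℕ) / 2 ^ (m + 1))
        - A ((2 * i + 1 : ℕ) / 2 ^ (m + 1)) ((2 * i + 1 + 1 : ℕ) / 2 ^ (m + 1))) := by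
  rw [equalErrorGrid, if_neg (by omega), show (2 * i + 1) / 2 = i by omega]

theorem gridError_equalErrorGrid_even (A : ℝ → ℝ → E) (m i : ℕ) :
    gridError A (equalErrorGrid A) (m + 1) (2 * i)
      = (1 / 2 : ℝ) • (gridError A (equalErrorGrid A) m i + midpointDefect A m i) := by
  simp only [gridError, midpointDefect, equalErrorGrid_two_mul, equalErrorGrid_two_mul_add_one]
  module

theorem gridError_equalErrorGrid_odd (A : ℝ → ℝ → E) (m i : ℕ) :
    gridError A (equalErrorGrid A) (m + 1) (2 * i + 1)
      = (1 / 2 : ℝ) • (gridError A (equalErrorGrid A) m i + midpointDefect A m i) := by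
  have h := equalErrorGrid_two_mul A m (i + 1)
  rw [mul_add, mul_one] at h
  simp only [gridError, midpointDefect, equalErrorGrid_two_mul_add_one, h]
  module

/-- For `ρ > 1/2` (an exponent smaller than one), halving the error in each refinement keeps it of
the right order at all levels. -/
theorem isGridSewing_equalErrorGrid {A : ℝ → ℝ → E} {C θ : ℝ} (hA : AlmostAdditive A C θ)
    (hθ : 0 < θ) (hρ : 1 / 2 < (1 / 2 : ℝ) ^ θ) (M : ℕ) :
    IsGridSewing A (C / (2 * (1 / 2 : ℝ) ^ θ - 1)) ((1 / 2 : ℝ) ^ θ) M (equalErrorGrid A) := by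
  set ρ : ℝ := (1 / 2 : ℝ) ^ θ with hρd
  have hρ0 : 0 < ρ := by positivity
  have hC := hA.nonneg
  set K : ℝ := C / (2 * ρ - 1) with hK
  have hK' : K * (2 * ρ - 1) = C := div_mul_cancel₀ _ (by linarith)
  have hK0 : 0 ≤ K := div_nonneg hC (by linarith)
  refine ⟨fun m i _ => equalErrorGrid_two_mul A m i, fun m i _ => ?_⟩
  induction m generalizing i with
  | zero =>
    intro hi
    obtain rfl : i = 0 := by simpa using hi
    simpa [gridError, equalErrorGrid] using hK0
  | succ m ih =>
    intro hi
    have hi' : i / 2 < 2 ^ m := by rw [pow_succ] at hi; omega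
    have hstep : ‖(1 / 2 : ℝ) • (gridError A (equalErrorGrid A) m (i / 2)
        + midpointDefect A m (i / 2))‖ ≤ K * ρ ^ (m + 1) := by
      rw [norm_smul, Real.norm_of_nonneg (by norm_num)]
      have h1 := ih (i / 2) (by omega) hi'
      have h2 := hA.norm_midpointDefect_le hθ hi'
      calc _ ≤ 1 / 2 * (K * ρ ^ m + C * ρ ^ m) := by
            gcongr
            exact (norm_add_le _ _).trans (add_le_add h1 h2)
        _ = K * ρ ^ (m + 1) := by rw [← hK']; ring
    rcases Nat.even_or_odd' i with ⟨k, rfl | rfl⟩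
    · rw [gridError_equalErrorGrid_even]
      simpa using hstep
    · rw [gridError_equalErrorGrid_odd]
      rwa [show (2 * k + 1) / 2 = k by omega] at hstep

theorem exists_forall_isGridSewing {A : ℝ → ℝ → E} {C θ : ℝ} (hA : AlmostAdditive A C θ)
    (hθ : 0 < θ) (hθ1 : θ ≠ 1) :
    ∃ K, 0 ≤ K ∧ ∀ M, ∃ j, IsGridSewing A K ((1 / 2 : ℝ) ^ θ) M j := by
  rcases hθ1.lt_or_gt with h | h
  · have hρ : 1 / 2 < (1 / 2 : ℝ) ^ θ := by
      simpa using Real.rpow_lt_rpow_of_exponent_gt (x := 1 / 2) (by norm_num) (by norm_num) h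
    exact ⟨_, div_nonneg hA.nonneg (by linarith),
      fun M => ⟨_, isGridSewing_equalErrorGrid hA hθ hρ M⟩⟩
  · have hρ : (1 / 2 : ℝ) ^ θ < 1 / 2 := by
      simpa using Real.rpow_lt_rpow_of_exponent_gt (x := 1 / 2) (by norm_num) (by norm_num) h
    exact ⟨_, div_nonneg hA.nonneg (by linarith), exists_isGridSewing_of_lt hA hθ hρ⟩

end Sewing

section Chaining

variable {E : Type*} [NormedAddCommGroup E]

/-- The dyadic number of level `m` below `t` is `dyadicIndex m t / 2 ^ m`. -/
def dyadicIndex (m : ℕ) (t : ℝ) : ℕ := ⌊t * 2 ^ m⌋₊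

/-- The largest dyadic number of level `m` which is not above `t`. -/
def dyadicFloor (m : ℕ) (t : ℝ) : ℝ := dyadicIndex m t / 2 ^ m

theorem dyadicFloor_nonneg (m : ℕ) (t : ℝ) : 0 ≤ dyadicFloor m t := by
  unfold dyadicFloor; positivity

theorem dyadicFloor_le (m : ℕ) {t : ℝ} (ht : 0 ≤ t) : dyadicFloor m t ≤ t := by
  rw [dyadicFloor, div_le_iff₀ (by positivity)]
  exact Nat.floor_le (by positivity)

theorem lt_dyadicFloor_add (m : ℕ) (t : ℝ) : t < dyadicFloor m t + 1 / 2 ^ m := by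
  rw [dyadicFloor, ← add_div, lt_div_iff₀ (by positivity)]
  exact Nat.lt_floor_add_one _

theorem dyadicIndex_le (m : ℕ) {t : ℝ} (ht : t ≤ 1) : dyadicIndex m t ≤ 2 ^ m := by
  have h : t * 2 ^ m ≤ ((2 ^ m : ℕ) : ℝ) := by
    push_cast
    exact mul_le_of_le_one_left (by positivity) ht
  exact Nat.floor_le_of_le h

theorem dyadicIndex_succ (m : ℕ) (t : ℝ) :
    dyadicIndex (m + 1) t = 2 * dyadicIndex m t ∨
      dyadicIndex (m + 1) t = 2 * dyadicIndex m t + 1 := by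
  have h : dyadicIndex m t = dyadicIndex (m + 1) t / 2 := by
    have := Nat.floor_div_natCast (t * 2 ^ (m + 1)) 2
    rw [dyadicIndex, dyadicIndex, ← this]
    congr 1
    push_cast; rw [pow_succ]; ring
  omega

theorem dyadicIndex_eq_or {m : ℕ} {s t : ℝ} (hs : 0 ≤ s) (hst : s ≤ t) (h : t - s ≤ 1 / 2 ^ m) :
    dyadicIndex m t = dyadicIndex m s ∨ dyadicIndex m t = dyadicIndex m s + 1 := by
  have h1 : dyadicIndex m s ≤ dyadicIndex m t := Nat.floor_le_floor (by gcongr)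
  have h2 : dyadicIndex m t ≤ dyadicIndex m s + 1 := by
    rw [dyadicIndex, dyadicIndex, ← Nat.floor_add_one (by positivity)]
    apply Nat.floor_le_floor
    rw [le_div_iff₀ (by positivity)] at h
    linarith
  omega

/-- The function on `[0, 1]` which a grid function at level `M` gives, extended beyond the grid
points by the increments of `A`. -/
def gridExtension (A : ℝ → ℝ → E) (j : ℕ → ℕ → E) (M : ℕ) (t : ℝ) : E :=
  j M (dyadicIndex M t) + A (dyadicFloor M t) t

/-- The error between `gridExtension` and its increment from the dyadic floor of level `m`. -/
def floorError (A : ℝ → ℝ → E) (j : ℕ → ℕ → E) (M m : ℕ) (t : ℝ) : E :=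
  gridExtension A j M t - j m (dyadicIndex m t) - A (dyadicFloor m t) t

theorem norm_floorError_le {A : ℝ → ℝ → E} {C θ K : ℝ} {M : ℕ} {j : ℕ → ℕ → E}
    (hA : AlmostAdditive A C θ) (hθ : 0 < θ) (hK : 0 ≤ K)
    (hj : IsGridSewing A K ((1 / 2 : ℝ) ^ θ) M j) {t : ℝ} (ht0 : 0 ≤ t) (ht1 : t ≤ 1)
    {m : ℕ} (hm : m ≤ M) :
    ‖floorError A j M m t‖
      ≤ (K * (1 / 2 : ℝ) ^ θ + C) / (1 - (1 / 2 : ℝ) ^ θ) * ((1 / 2 : ℝ) ^ θ) ^ m := by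
  set ρ : ℝ := (1 / 2 : ℝ) ^ θ with hρd
  have hρ0 : 0 < ρ := by positivity
  have hρ1 : ρ < 1 := Real.rpow_lt_one (by norm_num) (by norm_num) hθ
  have hC := hA.nonneg
  set L : ℝ := (K * ρ + C) / (1 - ρ) with hL
  have hL' : L * (1 - ρ) = K * ρ + C := div_mul_cancel₀ _ (by linarith)
  have hL0 : 0 ≤ L := div_nonneg (by positivity) (by linarith)
  have key : ∀ d m, m + d = M → ‖floorError A j M m t‖ ≤ L * ρ ^ m := by
    intro d
    induction d with
    | zero =>
      intro m hm
      obtain rfl : m = M := hm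
      simp only [floorError, gridExtension, add_sub_cancel_left, sub_self, norm_zero]
      positivity
    | succ d ih =>
      intro m hm
      have hstep : ‖floorError A j M m t - floorError A j M (m + 1) t‖ ≤ (K * ρ + C) * ρ ^ m := by
        rcases dyadicIndex_succ m t with h | h
        · have hf : dyadicFloor (m + 1) t = dyadicFloor m t := by
            rw [dyadicFloor, dyadicFloor, h]; push_cast; rw [pow_succ]; field_simp
          have : floorError A j M m t - floorError A j M (m + 1) t = 0 := by
            simp only [floorError, hf, h, hj.consistent m _ (by omega : m < M)]
            abel
          rw [this, norm_zero]
          positivity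
        · have hp : dyadicFloor m t = ((2 * dyadicIndex m t : ℕ) : ℝ) / 2 ^ (m + 1) := by
            rw [dyadicFloor]; push_cast; rw [pow_succ]; field_simp
          have hq : dyadicFloor (m + 1) t = ((2 * dyadicIndex m t + 1 : ℕ) : ℝ) / 2 ^ (m + 1) := by
            rw [dyadicFloor, h]
          have hlt : 2 * dyadicIndex m t < 2 ^ (m + 1) := by
            have := dyadicIndex_le (m + 1) ht1
            omega
          have e : floorError A j M m t - floorError A j M (m + 1) t
              = gridError A j (m + 1) (2 * dyadicIndex m t)
                - (A (dyadicFloor m t) t - A (dyadicFloor m t) (dyadicFloor (m + 1) t)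
                  - A (dyadicFloor (m + 1) t) t) := by
            simp only [floorError, gridError, h, hj.consistent m _ (by omega : m < M), ← hp, ← hq]
            abel
          have b1 := hj.bound (m + 1) _ (by omega) hlt
          have b2 := hA.norm_le hθ (dyadicFloor_nonneg m t)
            (by rw [hp, hq]; gcongr; omega : dyadicFloor m t ≤ dyadicFloor (m + 1) t)
            (dyadicFloor_le _ ht0) ht1
            (by linarith [lt_dyadicFloor_add m t] : t - dyadicFloor m t ≤ 1 / 2 ^ m)
          rw [two_inv_pow_rpow] at b2
          rw [e]
          refine (norm_sub_le _ _).trans ((add_le_add b1 b2).trans_eq ?_)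
          ring
      calc ‖floorError A j M m t‖
          ≤ ‖floorError A j M m t - floorError A j M (m + 1) t‖ + ‖floorError A j M (m + 1) t‖ := by
            simpa using norm_add_le (floorError A j M m t - floorError A j M (m + 1) t)
              (floorError A j M (m + 1) t)
        _ ≤ (K * ρ + C) * ρ ^ m + L * ρ ^ (m + 1) := add_le_add hstep (ih (m + 1) (by omega))
        _ = L * ρ ^ m := by rw [← hL']; ring
  exact key (M - m) m (by omega)

/-- The increments of `gridExtension` are close to `A` with a constant which does not depend on the
level of the grid. -/
theorem exists_norm_gridExtension_sub_le {A : ℝ → ℝ → E} {C θ K : ℝ}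
    (hA : AlmostAdditive A C θ) (hθ : 0 < θ) (hK : 0 ≤ K) :
    ∃ K', ∀ M j, IsGridSewing A K ((1 / 2 : ℝ) ^ θ) M j → ∀ m ≤ M, ∀ s t, 0 ≤ s → s ≤ t → t ≤ 1 →
      t - s ≤ 1 / 2 ^ m →
        ‖gridExtension A j M t - gridExtension A j M s - A s t‖ ≤ K' * ((1 / 2 : ℝ) ^ θ) ^ m := by
  set ρ : ℝ := (1 / 2 : ℝ) ^ θ with hρd
  have hρ0 : 0 < ρ := by positivity
  have hC := hA.nonneg
  set L : ℝ := (K * ρ + C) / (1 - ρ) with hL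
  refine ⟨L + L + K + C * 2 ^ θ + C * 2 ^ θ, fun M j hj m hm s t hs hst ht hd => ?_⟩
  have bt := norm_floorError_le hA hθ hK hj (hs.trans hst) ht hm
  have bs := norm_floorError_le hA hθ hK hj hs (hst.trans ht) hm
  rw [← hρd, ← hL] at bt bs
  have h2 : ∀ x, x ≤ 2 * (1 / 2 ^ m : ℝ) → 0 ≤ x → C * x ^ θ ≤ C * 2 ^ θ * ρ ^ m := by
    intro x hx hx0
    rw [hρd, ← two_inv_pow_rpow, mul_assoc, ← Real.mul_rpow (by norm_num) (by positivity)]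
    gcongr
  have hm0 : (0 : ℝ) < 1 / 2 ^ m := by positivity
  have ls := lt_dyadicFloor_add m s
  have lt := lt_dyadicFloor_add m t
  have fs := dyadicFloor_le m hs
  have ft := dyadicFloor_le m (hs.trans hst)
  have ps := dyadicFloor_nonneg m s
  have b1 := (hA _ _ _ ps fs hst ht).trans (h2 _ (by linarith) (by linarith))
  rcases dyadicIndex_eq_or hs hst hd with h | h
  · have hf : dyadicFloor m t = dyadicFloor m s := by rw [dyadicFloor, dyadicFloor, h]
    have e : gridExtension A j M t - gridExtension A j M s - A s t
        = floorError A j M m t - floorError A j M m s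
          + (A (dyadicFloor m s) t - A (dyadicFloor m s) s - A s t) := by
      simp only [floorError, h, hf]; abel
    rw [e]
    calc _ ≤ L * ρ ^ m + L * ρ ^ m + C * 2 ^ θ * ρ ^ m :=
          (norm_add_le _ _).trans (add_le_add ((norm_sub_le _ _).trans (add_le_add bt bs)) b1)
      _ ≤ L * ρ ^ m + L * ρ ^ m + C * 2 ^ θ * ρ ^ m
          + (K * ρ ^ m + C * 2 ^ θ * ρ ^ m) := le_add_of_nonneg_right (by positivity)
      _ = _ := by ring
  · have hf : dyadicFloor m t = ((dyadicIndex m s + 1 : ℕ) : ℝ) / 2 ^ m := by rw [dyadicFloor, h]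
    have hle : dyadicFloor m s ≤ dyadicFloor m t := by
      rw [hf, dyadicFloor]; gcongr; omega
    have b2 := (hA _ _ _ ps hle ft ht).trans (h2 _ (by linarith) (by linarith))
    have b3 := hj.bound m (dyadicIndex m s) hm (by have := dyadicIndex_le m ht; omega)
    have e : gridExtension A j M t - gridExtension A j M s - A s t
        = floorError A j M m t - floorError A j M m s + gridError A j m (dyadicIndex m s)
          + (A (dyadicFloor m s) t - A (dyadicFloor m s) s - A s t)
          - (A (dyadicFloor m s) t - A (dyadicFloor m s) (dyadicFloor m t)
            - A (dyadicFloor m t) t) := by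
      have : A (dyadicIndex m s / 2 ^ m) ((dyadicIndex m s + 1 : ℕ) / 2 ^ m)
        = A (dyadicFloor m s) (dyadicFloor m t) := by rw [hf, dyadicFloor]
      simp only [floorError, gridError, h, this]; abel
    rw [e]
    calc _ ≤ L * ρ ^ m + L * ρ ^ m + K * ρ ^ m + C * 2 ^ θ * ρ ^ m + C * 2 ^ θ * ρ ^ m :=
          (norm_sub_le _ _).trans (add_le_add ((norm_add_le _ _).trans (add_le_add
            ((norm_add_le _ _).trans (add_le_add ((norm_sub_le _ _).trans (add_le_add bt bs)) b3))
            b1)) b2)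
      _ = _ := by ring

/-- **Sewing lemma on the unit interval**, for both kinds of exponents: above one, the increments
of `J` are the limits of Riemann sums of `A`; below one, `J` is far from unique, but exists. -/
theorem exists_sewing_unit [NormedSpace ℝ E] [FiniteDimensional ℝ E] {A : ℝ → ℝ → E} {C θ : ℝ}
    (hA : AlmostAdditive A C θ) (hθ : 0 < θ) (hθ1 : θ ≠ 1) :
    ∃ (J : ℝ → E) (K : ℝ), ∀ s t, 0 ≤ s → s < t → t ≤ 1 →
      ‖J t - J s - A s t‖ ≤ K * (t - s) ^ θ := by
  have : ProperSpace E := FiniteDimensional.proper ℝ E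
  obtain ⟨K, hK, hgrid⟩ := exists_forall_isGridSewing hA hθ hθ1
  choose j hj using hgrid
  obtain ⟨K', hK'⟩ := exists_norm_gridExtension_sub_le hA hθ hK
  set ρ : ℝ := (1 / 2 : ℝ) ^ θ with hρd
  have hρ0 : 0 < ρ := by positivity
  set F : ℕ → ℝ → E := fun M t => gridExtension A (j M) M t - gridExtension A (j M) M 0 with hF
  have hF0 : ∀ M ≥ 0, ∀ t, 0 ≤ t → t ≤ 1 → ‖F M t - A 0 t‖ ≤ K' := by
    intro M hM t ht0 ht1
    simpa using hK' M (j M) (hj M) 0 hM 0 t le_rfl ht0 ht1 (by simpa using ht1)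
  -- the limit is taken along a fixed ultrafilter, which needs no choice of a subsequence
  let U : Ultrafilter ℕ := Filter.hyperfilter ℕ
  have hlim : ∀ t : ℝ, ∃ y : E, 0 ≤ t → t ≤ 1 → Filter.Tendsto (F · t) U (nhds y) := by
    intro t
    by_cases ht : 0 ≤ t ∧ t ≤ 1
    · have hc : IsCompact (Metric.closedBall (A 0 t) K') := isCompact_closedBall _ _
      obtain ⟨y, -, hy⟩ := hc.ultrafilter_le_nhds' (U.map (F · t))
        (Filter.mem_map.2 <| Filter.univ_mem' fun M => by
          change F M t ∈ Metric.closedBall (A 0 t) K'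
          rw [Metric.mem_closedBall, dist_eq_norm]
          exact hF0 M (Nat.zero_le _) t ht.1 ht.2)
      exact ⟨y, fun _ _ => hy⟩
    · exact ⟨0, fun h0 h1 => absurd ⟨h0, h1⟩ ht⟩
  choose J hJ using hlim
  refine ⟨J, K' / ρ, fun s t hs hst ht => ?_⟩
  obtain ⟨m, hm1, hm2⟩ := exists_nat_pow_near_of_lt_one (x := t - s) (y := (1 / 2 : ℝ))
    (by linarith) (by linarith) (by norm_num) (by norm_num)
  rw [one_div_pow] at hm1 hm2
  have hlim := (((hJ t (hs.trans hst.le) ht).sub (hJ s hs (hst.le.trans ht))).sub_const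
    (A s t)).norm
  have hev : ∀ᶠ M in (U : Filter ℕ), ‖F M t - F M s - A s t‖ ≤ K' * ρ ^ m := by
    have h1 : ∀ᶠ M in (U : Filter ℕ), m ≤ M :=
      (Filter.eventually_ge_atTop m).filter_mono Nat.hyperfilter_le_atTop
    filter_upwards [h1] with M hM
    simpa [hF] using hK' M (j M) (hj M) m hM s t hs hst.le ht hm2
  have hK'0 : 0 ≤ K' := (norm_nonneg _).trans (hF0 0 le_rfl 0 le_rfl zero_le_one)
  calc ‖J t - J s - A s t‖ ≤ K' * ρ ^ m := le_of_tendsto hlim hev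
    _ = K' / ρ * ρ ^ (m + 1) := by rw [pow_succ]; field_simp
    _ ≤ K' / ρ * (t - s) ^ θ := by
      have : ρ ^ (m + 1) ≤ (t - s) ^ θ := by
        rw [hρd, ← two_inv_pow_rpow]
        exact Real.rpow_le_rpow (by positivity) hm1.le hθ.le
      have h0 : 0 ≤ K' / ρ := by positivity
      gcongr

/-- The sewing lemma on `[0, T]`. -/
theorem exists_sewing [NormedSpace ℝ E] [FiniteDimensional ℝ E] {T : ℝ} (hT : 0 < T)
    {A : Set.Icc 0 T → Set.Icc 0 T → E} {C θ : ℝ} (hθ : 0 < θ) (hθ1 : θ ≠ 1)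
    (hA : ∀ s u t : Set.Icc 0 T, s ≤ u → u ≤ t →
      ‖A s t - A s u - A u t‖ ≤ C * ((t : ℝ) - s) ^ θ) :
    ∃ (J : Set.Icc 0 T → E) (K : ℝ), ∀ s t : Set.Icc 0 T, s < t →
      ‖J t - J s - A s t‖ ≤ K * ((t : ℝ) - s) ^ θ := by
  let π : ℝ → Set.Icc 0 T := fun r => Set.projIcc 0 T hT.le (T * r)
  have hπ : ∀ r, 0 ≤ r → r ≤ 1 → ((π r : Set.Icc 0 T) : ℝ) = T * r := fun r h0 h1 => by
    simp only [π]
    rw [Set.projIcc_of_mem hT.le ⟨by positivity, mul_le_of_le_one_right hT.le h1⟩]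
  have hmono : Monotone π := fun a b h => Set.monotone_projIcc _ (by gcongr)
  have hA' : AlmostAdditive (fun s t => A (π s) (π t)) (C * T ^ θ) θ := by
    intro s u t hs hsu hut ht
    have h := hA (π s) (π u) (π t) (hmono hsu) (hmono hut)
    rw [hπ s hs (by linarith), hπ t (by linarith) ht, ← mul_sub,
      Real.mul_rpow hT.le (by linarith), ← mul_assoc] at h
    exact h
  obtain ⟨J, K, hJ⟩ := exists_sewing_unit hA' hθ hθ1
  have hback : ∀ s : Set.Icc 0 T, π ((s : ℝ) / T) = s := fun s => by
    apply Subtype.ext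
    rw [hπ _ (div_nonneg s.2.1 hT.le) ((div_le_one hT).2 s.2.2), mul_div_cancel₀ _ hT.ne']
  refine ⟨fun t => J ((t : ℝ) / T), K / T ^ θ, fun s t hst => ?_⟩
  have h := hJ ((s : ℝ) / T) ((t : ℝ) / T) (div_nonneg s.2.1 hT.le) (by gcongr)
    ((div_le_one hT).2 t.2.2)
  rw [hback, hback, ← sub_div, Real.div_rpow (sub_nonneg.2 hst.le) hT.le] at h
  convert h using 1
  ring

/-- A function of two times which is additive and of order larger than one vanishes. -/
theorem eq_zero_of_additive {T : ℝ} {G : Set.Icc 0 T → Set.Icc 0 T → ℝ} {C θ : ℝ}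
    (hθ : 1 < θ) (hadd : ∀ s u t, G s t = G s u + G u t)
    (hG : ∀ s t, s ≠ t → |G s t| ≤ C * |(t : ℝ) - s| ^ θ) (s t : Set.Icc 0 T) : G s t = 0 := by
  have hself : ∀ r, G r r = 0 := fun r => by linarith [hadd r r r]
  have hbound : ∀ s t : Set.Icc 0 T, |G s t| ≤ |C| * |(t : ℝ) - s| ^ θ := by
    intro s t
    by_cases h : s = t
    · subst h; rw [hself, abs_zero]; positivity
    · exact (hG s t h).trans (by gcongr; exact le_abs_self C)
  have hn : ∀ n : ℕ, |G s t| ≤ |C| * |(t : ℝ) - s| ^ θ * ((n + 1 : ℕ) : ℝ) ^ (1 - θ) := by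
    intro n
    have hn0 : (0 : ℝ) < ((n + 1 : ℕ) : ℝ) := by positivity
    -- equally spaced points from `s` to `t`
    have hmem : ∀ k : ℕ, k ≤ n + 1 →
        (s : ℝ) + k / ((n + 1 : ℕ) : ℝ) * (t - s) ∈ Set.Icc (0 : ℝ) T := by
      intro k hk
      have := (convex_Icc (0 : ℝ) T).add_smul_sub_mem s.2 t.2
        (t := (k : ℝ) / ((n + 1 : ℕ) : ℝ))
        ⟨by positivity, by rw [div_le_one hn0]; exact_mod_cast hk⟩
      simpa using this
    let p : ℕ → Set.Icc 0 T := fun k => if h : k ≤ n + 1 then ⟨_, hmem k h⟩ else t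
    have hp : ∀ k, k ≤ n + 1 → ((p k : Set.Icc 0 T) : ℝ)
        = (s : ℝ) + k / ((n + 1 : ℕ) : ℝ) * (t - s) := fun k hk => by simp [p, hk]
    have hp0 : p 0 = s := Subtype.ext (by rw [hp 0 (by omega)]; simp)
    have hpn : p (n + 1) = t := Subtype.ext (by rw [hp _ le_rfl, div_self hn0.ne']; ring)
    have hsum : ∀ k, G s (p k) = ∑ i ∈ Finset.range k, G (p i) (p (i + 1)) := by
      intro k
      induction k with
      | zero => rw [hp0, hself]; simp
      | succ k ih => rw [Finset.sum_range_succ, ← ih, ← hadd]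
    rw [← hpn, hsum]
    refine (Finset.abs_sum_le_sum_abs _ _).trans ((Finset.sum_le_card_nsmul _ _
      (|C| * (|(t : ℝ) - s| / ((n + 1 : ℕ) : ℝ)) ^ θ) fun i hi => ?_).trans_eq ?_)
    · have hi' := Finset.mem_range.1 hi
      refine (hbound _ _).trans_eq ?_
      rw [hp i (by omega), hp (i + 1) (by omega)]
      congr 2
      rw [← abs_of_pos hn0, ← abs_div, abs_of_pos hn0]
      congr 1
      push_cast
      field_simp
      ring
    · rw [Finset.card_range, nsmul_eq_mul, Real.div_rpow (abs_nonneg _) hn0.le,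
        Real.rpow_sub hn0, Real.rpow_one, hpn]
      ring
  have hlim : Filter.Tendsto (fun n : ℕ => |C| * |(t : ℝ) - s| ^ θ * ((n + 1 : ℕ) : ℝ) ^ (1 - θ))
      Filter.atTop (nhds 0) := by
    have h1 := (tendsto_rpow_neg_atTop (y := θ - 1) (by linarith)).comp
      (tendsto_natCast_atTop_atTop.comp (Filter.tendsto_add_atTop_nat 1))
    have h2 := h1.const_mul (|C| * |(t : ℝ) - s| ^ θ)
    simpa [Function.comp_def] using h2
  exact abs_eq_zero.1 (le_antisymm (ge_of_tendsto' hlim hn) (abs_nonneg _))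

end Chaining

/-! ### Quasi-shuffle and deconcatenation are compatible -/

section Bialgebra

variable {A : Type*}

/-- The functional on `T(A)` with given values on words. -/
abbrev linExt (g : List A → ℝ) : Module.Dual ℝ (Tensor A) := Finsupp.linearCombination ℝ g

theorem linExt_word (g : List A → ℝ) (w : List A) : linExt g (word w) = g w := by
  simp [linExt]

/-- The convolution product in terms of the values on words. -/
def wordConv (f g : List A → ℝ) (w : List A) : ℝ :=
  ∑ i ∈ Finset.range (w.length + 1), f (w.take i) * g (w.drop i)

theorem conv_linExt (f g : List A → ℝ) :
    conv (linExt f) (linExt g) = linExt (wordConv f g) := by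
  refine Finsupp.lhom_ext' fun w => LinearMap.ext_ring ?_
  change conv _ _ (word w) = linExt _ (word w)
  simp [conv_word, wordConv]

theorem wordConv_nil (f g : List A → ℝ) : wordConv f g [] = f [] * g [] := by
  simp [wordConv]

theorem wordConv_cons (f g : List A → ℝ) (a : A) (w : List A) :
    wordConv f g (a :: w) = f [] * g (a :: w) + wordConv (fun v => f (a :: v)) g w := by
  rw [wordConv, List.length_cons, Finset.sum_range_succ', add_comm]
  simp [wordConv]

theorem wordConv_assoc (f g h : List A → ℝ) (w : List A) :
    wordConv (wordConv f g) h w = wordConv f (wordConv g h) w := by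
  induction w generalizing f g with
  | nil => simp [wordConv_nil, mul_assoc]
  | cons a w ih =>
    have e : wordConv (fun v => wordConv f g (a :: v)) h w
        = f [] * wordConv (fun v => g (a :: v)) h w
          + wordConv (wordConv (fun v => f (a :: v)) g) h w := by
      simp only [wordConv_cons f g]
      simp only [wordConv, add_mul, Finset.sum_add_distrib, Finset.mul_sum, mul_assoc]
    rw [wordConv_cons, e, ih, wordConv_cons f, wordConv_cons g h, wordConv_nil]
    ring

theorem conv_word_append_singleton (α β : Module.Dual ℝ (Tensor A)) (w : List A) (a : A) :
    conv α β (word (w ++ [a]))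
      = conv α (β ∘ₗ snoc.flip (letter a)) (word w) + α (word (w ++ [a])) * β (word []) := by
  rw [conv_word, conv_word, List.length_append, List.length_singleton,
    Finset.sum_range_succ _ (w.length + 1)]
  congr 1
  · refine Finset.sum_congr rfl fun i hi => ?_
    have hi' : i ≤ w.length := Nat.lt_succ_iff.1 (Finset.mem_range.1 hi)
    rw [List.take_append_of_le_length hi', List.drop_append_of_le_length hi',
      LinearMap.comp_apply, LinearMap.flip_apply, snoc_word_letter]
  · rw [List.take_of_length_le (by simp), List.drop_of_length_le (by simp)]

/-- `∇(hx) = ∇(h) (𝟏 ⊗ x) + hx ⊗ 𝟏`. -/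
theorem conv_snoc (α β : Module.Dual ℝ (Tensor A)) (h : Tensor A) (x : A →₀ ℝ) :
    conv α β (snoc h x) = conv α (β ∘ₗ snoc.flip x) h + α (snoc h x) * β (word []) := by
  induction x using Finsupp.induction_linear with
  | zero => simp [conv]
  | add x y hx hy =>
    have : conv α (β ∘ₗ snoc.flip (x + y)) h
        = conv α (β ∘ₗ snoc.flip x) h + conv α (β ∘ₗ snoc.flip y) h := by
      simp [conv, LinearMap.comp_add, TensorProduct.map_add_right]
    rw [map_add, map_add, hx, hy, this, map_add]
    ring
  | single a r =>
    have h1 : (Finsupp.single a r : A →₀ ℝ) = r • letter a := by simp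
    have h2 : conv α (β ∘ₗ snoc.flip (r • letter a)) h
        = r * conv α (β ∘ₗ snoc.flip (letter a)) h := by
      rw [map_smul, LinearMap.comp_smul, conv, TensorProduct.map_smul_right]
      simp only [LinearMap.comp_apply, LinearMap.smul_apply, map_smul, smul_eq_mul, conv]
    have h3 : conv α β (snoc h (letter a)) = conv α (β ∘ₗ snoc.flip (letter a)) h
        + α (snoc h (letter a)) * β (word []) := by
      clear h2
      induction h using Finsupp.induction_linear with
      | zero => simp
      | add h k hh hk =>
        rw [map_add, LinearMap.add_apply, map_add, hh, hk, map_add, map_add]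
        ring
      | single w c =>
        have h4 : (Finsupp.single w c : Tensor A) = c • word w := by simp
        simp only [h4, map_smul, LinearMap.smul_apply, snoc_word_letter,
          conv_word_append_singleton, smul_eq_mul]
        ring
    rw [h1, h2, map_smul, map_smul, map_smul, h3, smul_eq_mul, smul_eq_mul]
    ring

/-- Deconcatenation is multiplicative for the quasi-shuffle product. -/
theorem conv_quasiShuffle (B : CommBracket A) (α β : Module.Dual ℝ (Tensor A)) (u v : List A) :
    conv α β (quasiShuffle B (word u) (word v)) =
      ∑ i ∈ Finset.range (u.length + 1), ∑ j ∈ Finset.range (v.length + 1),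
        α (quasiShuffle B (word (u.take i)) (word (v.take j)))
          * β (quasiShuffle B (word (u.drop i)) (word (v.drop j))) := by
  induction u using List.reverseRecOn generalizing v β with
  | nil => simp [quasiShuffle_nil_left, conv_word]
  | append_singleton u a ihu =>
  induction v using List.reverseRecOn generalizing β with
  | nil => simp [quasiShuffle_nil_right, conv_word]
  | append_singleton v b ihv =>
  have hu : ∀ i ∈ Finset.range (u.length + 1), (u ++ [a]).take i = u.take i ∧
      (u ++ [a]).drop i = u.drop i ++ [a] := fun i hi => by
    have := Nat.lt_succ_iff.1 (Finset.mem_range.1 hi)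
    exact ⟨List.take_append_of_le_length this, List.drop_append_of_le_length this⟩
  have hv : ∀ j ∈ Finset.range (v.length + 1), (v ++ [b]).take j = v.take j ∧
      (v ++ [b]).drop j = v.drop j ++ [b] := fun j hj => by
    have := Nat.lt_succ_iff.1 (Finset.mem_range.1 hj)
    exact ⟨List.take_append_of_le_length this, List.drop_append_of_le_length this⟩
  have hul : (u ++ [a]).take (u.length + 1) = u ++ [a] ∧ (u ++ [a]).drop (u.length + 1) = [] :=
    ⟨List.take_of_length_le (by simp), List.drop_of_length_le (by simp)⟩
  have hvl : (v ++ [b]).take (v.length + 1) = v ++ [b] ∧ (v ++ [b]).drop (v.length + 1) = [] :=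
    ⟨List.take_of_length_le (by simp), List.drop_of_length_le (by simp)⟩
  rw [quasiShuffle_append_append, map_add, map_add, conv_snoc, conv_snoc, conv_snoc, ihu, ihu, ihv]
  simp only [List.length_append, List.length_singleton]
  simp only [Finset.sum_range_succ _ (u.length + 1), Finset.sum_range_succ _ (v.length + 1),
    hul, hvl]
  have hA : ∀ i ∈ Finset.range (u.length + 1), ∀ j ∈ Finset.range (v.length + 1),
      α (quasiShuffle B (word ((u ++ [a]).take i)) (word ((v ++ [b]).take j)))
        * β (quasiShuffle B (word ((u ++ [a]).drop i)) (word ((v ++ [b]).drop j)))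
      = α (quasiShuffle B (word (u.take i)) (word ((v ++ [b]).take j)))
          * (β ∘ₗ snoc.flip (letter a))
            (quasiShuffle B (word (u.drop i)) (word ((v ++ [b]).drop j)))
        + α (quasiShuffle B (word ((u ++ [a]).take i)) (word (v.take j)))
          * (β ∘ₗ snoc.flip (letter b))
            (quasiShuffle B (word ((u ++ [a]).drop i)) (word (v.drop j)))
        + α (quasiShuffle B (word (u.take i)) (word (v.take j)))
          * (β ∘ₗ snoc.flip (B.br (letter a) (letter b)))
            (quasiShuffle B (word (u.drop i)) (word (v.drop j))) := by
    intro i hi j hj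
    rw [(hu i hi).1, (hu i hi).2, (hv j hj).1, (hv j hj).2, quasiShuffle_append_append]
    simp only [map_add, LinearMap.comp_apply, LinearMap.flip_apply]
    ring
  have hB : ∀ i ∈ Finset.range (u.length + 1),
      β (quasiShuffle B (word ((u ++ [a]).drop i)) (word []))
        = (β ∘ₗ snoc.flip (letter a)) (quasiShuffle B (word (u.drop i)) (word [])) := by
    intro i hi
    rw [(hu i hi).2, quasiShuffle_nil_right, quasiShuffle_nil_right, LinearMap.comp_apply,
      LinearMap.flip_apply, snoc_word_letter]
  have hC : ∀ j ∈ Finset.range (v.length + 1),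
      β (quasiShuffle B (word []) (word ((v ++ [b]).drop j)))
        = (β ∘ₗ snoc.flip (letter b)) (quasiShuffle B (word []) (word (v.drop j))) := by
    intro j hj
    rw [(hv j hj).2, quasiShuffle_nil_left, quasiShuffle_nil_left, LinearMap.comp_apply,
      LinearMap.flip_apply, snoc_word_letter]
  rw [Finset.sum_congr rfl fun i hi => congrArg₂ (· + ·)
      (Finset.sum_congr rfl fun j hj => hA i hi j hj)
      (congrArg₂ (· * ·) (congrArg (fun x => α (quasiShuffle B (word x) (word (v ++ [b]))))
        (hu i hi).1) (hB i hi)),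
    Finset.sum_congr rfl fun j hj => congrArg₂ (· * ·)
      (congrArg (fun x => α (quasiShuffle B (word (u ++ [a])) (word x))) (hv j hj).1) (hC j hj)]
  simp only [Finset.sum_add_distrib, quasiShuffle_nil_left]
  rw [quasiShuffle_append_append]
  simp only [map_add]
  ring

end Bialgebra

section Homogeneous

variable {A : Type*} {ω : A → ℕ}

theorem wordWeight_nil : wordWeight ω [] = 0 := rfl

theorem wordWeight_append (u v : List A) :
    wordWeight ω (u ++ v) = wordWeight ω u + wordWeight ω v := by
  simp [wordWeight]

theorem wordWeight_cons (a : A) (w : List A) :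
    wordWeight ω (a :: w) = ω a + wordWeight ω w := by
  simp [wordWeight]

theorem wordWeight_pos {B : CommBracket A} (hω : IsIntrinsicWeight B ω) {w : List A} (hw : w ≠ []) :
    0 < wordWeight ω w := by
  obtain ⟨a, v, rfl⟩ := List.exists_cons_of_ne_nil hw
  rw [wordWeight_cons]
  have := hω.pos a
  omega

theorem length_le_wordWeight {B : CommBracket A} (hω : IsIntrinsicWeight B ω) (w : List A) :
    w.length ≤ wordWeight ω w := by
  induction w with
  | nil => simp
  | cons a w ih =>
    rw [wordWeight_cons, List.length_cons]
    have := hω.pos a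
    omega

theorem finite_setOf_wordWeight_eq [Finite A] {B : CommBracket A} (hω : IsIntrinsicWeight B ω)
    (n : ℕ) : {w : List A | wordWeight ω w = n}.Finite :=
  (List.finite_length_le A n).subset fun w hw => (length_le_wordWeight hω w).trans_eq hw

/-- The homogeneous component of `T(A)` of weight `k`. -/
abbrev weightSpace (ω : A → ℕ) (k : ℕ) : Submodule ℝ (Tensor A) :=
  Finsupp.supported ℝ ℝ {w | wordWeight ω w = k}

theorem snoc_mem_weightSpace {k l : ℕ} {h : Tensor A} (hh : h ∈ weightSpace ω k) {x : A →₀ ℝ}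
    (hx : x ∈ letterSpace ω l) : snoc h x ∈ weightSpace ω (k + l) := by
  rw [weightSpace, Finsupp.supported_eq_span_single] at hh
  induction hh using Submodule.span_induction with
  | mem y hy =>
    obtain ⟨w, hw, rfl⟩ := hy
    rw [letterSpace] at hx
    induction hx using Submodule.span_induction with
    | mem z hz =>
      obtain ⟨a, ha, rfl⟩ := hz
      change snoc (word w) (letter a) ∈ _
      rw [snoc_word_letter]
      refine Finsupp.single_mem_supported ℝ 1 ?_
      change wordWeight ω w = k at hw
      change ω a = l at ha
      change wordWeight ω (w ++ [a]) = k + l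
      rw [wordWeight_append, hw, wordWeight_cons, ha, wordWeight_nil, add_zero]
    | zero => simp
    | add y z _ _ hy hz => rw [map_add]; exact add_mem hy hz
    | smul r y _ hy => rw [map_smul]; exact Submodule.smul_mem _ _ hy
  | zero => simp
  | add y z _ _ hy hz => rw [map_add, LinearMap.add_apply]; exact add_mem hy hz
  | smul r y _ hy => rw [map_smul, LinearMap.smul_apply]; exact Submodule.smul_mem _ _ hy

theorem letter_mem_letterSpace (a : A) : letter a ∈ letterSpace ω (ω a) :=
  Submodule.subset_span ⟨a, rfl, rfl⟩

theorem br_letter_mem {B : CommBracket A} (hω : IsIntrinsicWeight B ω) (a b : A) :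
    B.br (letter a) (letter b) ∈ letterSpace ω (ω a + ω b) :=
  hω.graded _ _ (hω.pos a) (hω.pos b) _ (letter_mem_letterSpace a) _ (letter_mem_letterSpace b)

theorem quasiShuffle_mem_weightSpace {B : CommBracket A} (hω : IsIntrinsicWeight B ω)
    (u v : List A) :
    quasiShuffle B (word u) (word v) ∈ weightSpace ω (wordWeight ω u + wordWeight ω v) := by
  induction u using List.reverseRecOn generalizing v with
  | nil =>
    rw [quasiShuffle_nil_left]
    exact Finsupp.single_mem_supported ℝ 1 (by simp [wordWeight_nil])
  | append_singleton u a ihu =>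
  induction v using List.reverseRecOn with
  | nil =>
    rw [quasiShuffle_nil_right]
    exact Finsupp.single_mem_supported ℝ 1 (by simp [wordWeight_nil])
  | append_singleton v b ihv =>
  have h1 := snoc_mem_weightSpace (ihu (v ++ [b])) (letter_mem_letterSpace a)
  have h2 := snoc_mem_weightSpace ihv (letter_mem_letterSpace b)
  have h3 := snoc_mem_weightSpace (ihu v) (br_letter_mem hω a b)
  rw [quasiShuffle_append_append]
  simp only [wordWeight_append, wordWeight_cons, wordWeight_nil, add_zero] at h1 h2 h3 ⊢
  refine add_mem (add_mem ?_ ?_) ?_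
  · convert h1 using 2; ring
  · convert h2 using 2; ring
  · convert h3 using 2; ring

theorem linExt_congr {f g : List A → ℝ} {k : ℕ} (hfg : ∀ w, wordWeight ω w = k → f w = g w)
    {h : Tensor A} (hh : h ∈ weightSpace ω k) : linExt f h = linExt g h := by
  rw [linExt, linExt, Finsupp.linearCombination_apply, Finsupp.linearCombination_apply]
  refine Finsupp.sum_congr fun w hw => ?_
  rw [hfg w (hh hw)]

end Homogeneous

/-! ### Extension of truncated characters by one weight -/

section Dynkin

variable {A : Type*}

/-- `g` is a character of the quasi-shuffle algebra on the words of weight at most `n`. -/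
structure IsTruncatedCharacter (B : CommBracket A) (ω : A → ℕ) (n : ℕ) (g : List A → ℝ) :
    Prop where
  nil : g [] = 1
  mul : ∀ u v, wordWeight ω u + wordWeight ω v ≤ n →
    linExt g (quasiShuffle B (word u) (word v)) = g u * g v

/-- If `μ` vanishes at the empty word and at the relevant products, then convolution with `μ` acts
as a derivation on a product, up to the value of `μ` at this product. -/
theorem linExt_wordConv_quasiShuffle (B : CommBracket A) {g μ : List A → ℝ} (hg : g [] = 1)
    (hμ : μ [] = 0) {u v : List A} (hu : u ≠ []) (hv : v ≠ [])
    (h1 : ∀ i < u.length,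
      linExt g (quasiShuffle B (word (u.take i)) (word v)) = g (u.take i) * g v)
    (h2 : ∀ j < v.length,
      linExt g (quasiShuffle B (word u) (word (v.take j))) = g u * g (v.take j))
    (h3 : ∀ i < u.length, ∀ j < v.length, ¬ (i = 0 ∧ j = 0) →
      linExt μ (quasiShuffle B (word (u.drop i)) (word (v.drop j))) = 0) :
    linExt (wordConv g μ) (quasiShuffle B (word u) (word v)) =
      wordConv g μ u * g v + g u * wordConv g μ v
        + linExt μ (quasiShuffle B (word u) (word v)) := by
  have e1 : wordConv g μ u = ∑ i ∈ Finset.range u.length, g (u.take i) * μ (u.drop i) := by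
    rw [wordConv, Finset.sum_range_succ, List.drop_length, hμ, mul_zero, add_zero]
  have e2 : wordConv g μ v = ∑ j ∈ Finset.range v.length, g (v.take j) * μ (v.drop j) := by
    rw [wordConv, Finset.sum_range_succ, List.drop_length, hμ, mul_zero, add_zero]
  have e3 : ∑ i ∈ Finset.range u.length, ∑ j ∈ Finset.range v.length,
      linExt g (quasiShuffle B (word (u.take i)) (word (v.take j)))
        * linExt μ (quasiShuffle B (word (u.drop i)) (word (v.drop j)))
      = linExt μ (quasiShuffle B (word u) (word v)) := by
    rw [Finset.sum_eq_single_of_mem 0 (Finset.mem_range.2 (List.length_pos_iff.2 hu)),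
      Finset.sum_eq_single_of_mem 0 (Finset.mem_range.2 (List.length_pos_iff.2 hv))]
    · simp [quasiShuffle_nil_left, hg]
    · intro j hj hj0
      rw [h3 0 (List.length_pos_iff.2 hu) j (Finset.mem_range.1 hj) (by tauto), mul_zero]
    · intro i hi hi0
      refine Finset.sum_eq_zero fun j hj => ?_
      rw [h3 i (Finset.mem_range.1 hi) j (Finset.mem_range.1 hj) (by tauto), mul_zero]
  rw [← conv_linExt, conv_quasiShuffle]
  simp only [Finset.sum_range_succ _ u.length, Finset.sum_range_succ _ v.length,
    Finset.sum_add_distrib, List.take_length, List.drop_length, quasiShuffle_nil_left,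
    quasiShuffle_nil_right, linExt_word, hμ, mul_zero, add_zero]
  rw [e3, e1, e2, Finset.sum_mul, Finset.mul_sum, add_comm (linExt μ _), add_right_comm]
  congr 2
  · refine Finset.sum_congr rfl fun i hi => ?_
    rw [h1 i (Finset.mem_range.1 hi)]
    ring
  · refine Finset.sum_congr rfl fun j hj => ?_
    rw [h2 j (Finset.mem_range.1 hj)]
    ring

/-- The functional `λ` with `|w| g(w) = (g * λ)(w)` for all words, where `|w|` is the weight. -/
def dynkin (ω : A → ℕ) (g : List A → ℝ) : List A → ℝ
  | [] => 0
  | a :: w => wordWeight ω (a :: w) * g (a :: w)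
      - ∑ i ∈ Finset.range (w.length + 1), g (a :: w.take i) * dynkin ω g (w.drop i)
  termination_by w => w.length
  decreasing_by simp

theorem dynkin_nil (ω : A → ℕ) (g : List A → ℝ) : dynkin ω g [] = 0 := by
  rw [dynkin]

theorem dynkin_cons (ω : A → ℕ) (g : List A → ℝ) (a : A) (w : List A) :
    dynkin ω g (a :: w) = wordWeight ω (a :: w) * g (a :: w)
      - ∑ i ∈ Finset.range (w.length + 1), g (a :: w.take i) * dynkin ω g (w.drop i) := by
  rw [dynkin]

theorem wordConv_dynkin (ω : A → ℕ) {g : List A → ℝ} (hg : g [] = 1) (w : List A) :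
    wordConv g (dynkin ω g) w = wordWeight ω w * g w := by
  cases w with
  | nil => simp [wordConv_nil, wordWeight_nil, dynkin_nil]
  | cons a w =>
    rw [wordConv_cons, hg, dynkin_cons, wordConv]
    ring

theorem wordWeight_take_le (ω : A → ℕ) (w : List A) (i : ℕ) :
    wordWeight ω (w.take i) ≤ wordWeight ω w := by
  have := wordWeight_take_add_drop ω w i
  omega

theorem wordWeight_drop_le (ω : A → ℕ) (w : List A) (i : ℕ) :
    wordWeight ω (w.drop i) ≤ wordWeight ω w := by
  have := wordWeight_take_add_drop ω w i
  omega

theorem wordWeight_take_lt {B : CommBracket A} {ω : A → ℕ} (hω : IsIntrinsicWeight B ω)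
    {w : List A} {i : ℕ} (hi : i < w.length) : wordWeight ω (w.take i) < wordWeight ω w := by
  have := wordWeight_take_add_drop ω w i
  have := wordWeight_pos hω (w := w.drop i) (by simpa using hi)
  omega

theorem wordWeight_drop_lt {B : CommBracket A} {ω : A → ℕ} (hω : IsIntrinsicWeight B ω)
    {w : List A} (hw : w ≠ []) {i : ℕ} (hi : 0 < i) :
    wordWeight ω (w.drop i) < wordWeight ω w := by
  have := wordWeight_take_add_drop ω w i
  have := wordWeight_pos hω (w := w.take i) (by simpa using ⟨hi.ne', hw⟩)
  omega

/-- The functional `dynkin ω g` of a truncated character is an infinitesimal character. -/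
theorem IsTruncatedCharacter.dynkin_quasiShuffle {B : CommBracket A} {ω : A → ℕ}
    (hω : IsIntrinsicWeight B ω) {n : ℕ} {g : List A → ℝ} (hg : IsTruncatedCharacter B ω n g)
    (u v : List A) (hu : u ≠ []) (hv : v ≠ []) (huv : wordWeight ω u + wordWeight ω v ≤ n) :
    linExt (dynkin ω g) (quasiShuffle B (word u) (word v)) = 0 := by
  induction hk : u.length + v.length using Nat.strong_induction_on generalizing u v with
  | _ k ih =>
  subst hk
  have key := linExt_wordConv_quasiShuffle B hg.nil (μ := dynkin ω g) (dynkin_nil ω g) hu hv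
    (fun i _ => hg.mul _ _ (by have := wordWeight_take_le ω u i; omega))
    (fun j _ => hg.mul _ _ (by have := wordWeight_take_le ω v j; omega))
    (fun i hi j hj hij => ih _ (by simp only [List.length_drop]; omega) _ _ (by simpa using hi)
      (by simpa using hj)
      (by have := wordWeight_drop_le ω u i; have := wordWeight_drop_le ω v j; omega) rfl)
  have e : linExt (wordConv g (dynkin ω g)) (quasiShuffle B (word u) (word v))
      = ((wordWeight ω u + wordWeight ω v : ℕ) : ℝ) * (g u * g v) := by
    rw [linExt_congr (g := fun w => ((wordWeight ω u + wordWeight ω v : ℕ) : ℝ) * g w)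
      (fun w hw => by rw [wordConv_dynkin ω hg.nil, hw]) (quasiShuffle_mem_weightSpace hω u v),
      ← hg.mul u v huv]
    exact congrArg (fun F : Module.Dual ℝ (Tensor A) => F (quasiShuffle B (word u) (word v)))
      ((Finsupp.lhom_ext' fun w => LinearMap.ext_ring (by simp)) :
        linExt (fun w => ((wordWeight ω u + wordWeight ω v : ℕ) : ℝ) * g w)
          = ((wordWeight ω u + wordWeight ω v : ℕ) : ℝ) • linExt g)
  rw [e, wordConv_dynkin ω hg.nil, wordConv_dynkin ω hg.nil] at key
  push_cast at key
  linarith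

/-- The infinitesimal character `dynkin ω g`, replaced by `κ` on the words of weight `m`. -/
def dynkinWith (ω : A → ℕ) (m : ℕ) (κ g : List A → ℝ) (w : List A) : ℝ :=
  if wordWeight ω w = m then κ w else dynkin ω g w

/-- The extension of a truncated character `g` to the words of weight `m` for which the identity
`|w| g(w) = (g * λ)(w)` continues to hold with `λ = κ` on these words. -/
def dynkinExtension (ω : A → ℕ) (m : ℕ) (κ g : List A → ℝ) (w : List A) : ℝ :=
  if wordWeight ω w = m then (m : ℝ)⁻¹ * wordConv g (dynkinWith ω m κ g) w else g w

theorem wordConv_dynkinWith {ω : A → ℕ} {m : ℕ} {κ g : List A → ℝ} (hg : g [] = 1) {w : List A}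
    (hw : wordWeight ω w < m) :
    wordConv g (dynkinWith ω m κ g) w = wordWeight ω w * g w := by
  rw [← wordConv_dynkin ω hg, wordConv, wordConv]
  refine Finset.sum_congr rfl fun i _ => ?_
  rw [dynkinWith, if_neg (by have := wordWeight_drop_le ω w i; omega)]

/-- Characters extend from weight `n` to weight `n + 1`, with any infinitesimal character `κ` as
new component of the logarithmic derivative. -/
theorem IsTruncatedCharacter.dynkinExtension {B : CommBracket A} {ω : A → ℕ}
    (hω : IsIntrinsicWeight B ω) {n : ℕ} {g κ : List A → ℝ} (hg : IsTruncatedCharacter B ω n g)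
    (hκ : ∀ u v, u ≠ [] → v ≠ [] → linExt κ (quasiShuffle B (word u) (word v)) = 0) :
    IsTruncatedCharacter B ω (n + 1) (dynkinExtension ω (n + 1) κ g) := by
  have hnil : QuasiGeom.dynkinExtension ω (n + 1) κ g [] = 1 := by
    rw [QuasiGeom.dynkinExtension, if_neg (by rw [wordWeight_nil]; omega), hg.nil]
  refine ⟨hnil, fun u v huv => ?_⟩
  by_cases hu : u = []
  · rw [hu, quasiShuffle_nil_left, linExt_word, hnil, one_mul]
  by_cases hv : v = []
  · rw [hv, quasiShuffle_nil_right, linExt_word, hnil, mul_one]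
  have pu := wordWeight_pos hω hu
  have pv := wordWeight_pos hω hv
  have hlow : ∀ w, wordWeight ω w ≤ n → QuasiGeom.dynkinExtension ω (n + 1) κ g w = g w :=
    fun w hw => by rw [QuasiGeom.dynkinExtension, if_neg (by omega)]
  rw [hlow u (by omega), hlow v (by omega)]
  rcases Nat.lt_or_ge n (wordWeight ω u + wordWeight ω v) with h | h
  swap
  · rw [← hg.mul u v h]
    exact linExt_congr (fun w hw => hlow w (by omega)) (quasiShuffle_mem_weightSpace hω u v)
  have hn : wordWeight ω u + wordWeight ω v = n + 1 := by omega
  set μ := dynkinWith ω (n + 1) κ g with hμ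
  have hμ0 : μ [] = 0 := by
    rw [hμ, dynkinWith, if_neg (by rw [wordWeight_nil]; omega), dynkin_nil]
  have hμuv : ∀ u' v', u' ≠ [] → v' ≠ [] → wordWeight ω u' + wordWeight ω v' ≤ n + 1 →
      linExt μ (quasiShuffle B (word u') (word v')) = 0 := by
    intro u' v' hu' hv' h'
    rcases Nat.lt_or_ge n (wordWeight ω u' + wordWeight ω v') with hk | hk
    · rw [← hκ u' v' hu' hv']
      exact linExt_congr (fun w hw => by rw [hμ, dynkinWith, if_pos (by omega)])
        (quasiShuffle_mem_weightSpace hω u' v')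
    · rw [← hg.dynkin_quasiShuffle hω u' v' hu' hv' hk]
      exact linExt_congr (fun w hw => by rw [hμ, dynkinWith, if_neg (by omega)])
        (quasiShuffle_mem_weightSpace hω u' v')
  have key := linExt_wordConv_quasiShuffle B hg.nil hμ0 hu hv
    (fun i hi => hg.mul _ _ (by have := wordWeight_take_lt hω hi; omega))
    (fun j hj => hg.mul _ _ (by have := wordWeight_take_lt hω hj; omega))
    (fun i hi j hj _ => hμuv _ _ (by simpa using hi) (by simpa using hj)
      (by have := wordWeight_drop_le ω u i; have := wordWeight_drop_le ω v j; omega))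
  rw [wordConv_dynkinWith hg.nil (by omega), wordConv_dynkinWith hg.nil (by omega),
    hμuv u v hu hv hn.le] at key
  have e : linExt (QuasiGeom.dynkinExtension ω (n + 1) κ g) (quasiShuffle B (word u) (word v))
      = ((n + 1 : ℕ) : ℝ)⁻¹ * linExt (wordConv g μ) (quasiShuffle B (word u) (word v)) := by
    rw [linExt_congr (g := fun w => ((n + 1 : ℕ) : ℝ)⁻¹ * wordConv g μ w)
      (fun w hw => by rw [QuasiGeom.dynkinExtension, if_pos (by omega)])
      (quasiShuffle_mem_weightSpace hω u v)]
    exact congrArg (fun F : Module.Dual ℝ (Tensor A) => F (quasiShuffle B (word u) (word v)))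
      ((Finsupp.lhom_ext' fun w => LinearMap.ext_ring (by simp)) :
        linExt (fun w => ((n + 1 : ℕ) : ℝ)⁻¹ * wordConv g μ w)
          = ((n + 1 : ℕ) : ℝ)⁻¹ • linExt (wordConv g μ))
  have hn' : ((wordWeight ω u : ℝ) + wordWeight ω v) = ((n + 1 : ℕ) : ℝ) := by exact_mod_cast hn
  rw [e, key, inv_mul_eq_iff_eq_mul₀ (by positivity), ← hn']
  ring

end Dynkin

/-! ### Infinitesimal characters with given values on letters -/

section Letters

variable {A : Type*}

/-- The operator `-[x, ·]` on `ℝ^A`. -/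
def negBr (B : CommBracket A) : (A →₀ ℝ) →ₗ[ℝ] Module.End ℝ (A →₀ ℝ) := (-1 : ℝ) • B.br

theorem negBr_apply (B : CommBracket A) (x y : A →₀ ℝ) : negBr B x y = -B.br x y := by
  simp [negBr]

theorem negBr_br (B : CommBracket A) (x y : A →₀ ℝ) :
    negBr B (B.br x y) = (-1 : ℝ) • (negBr B x * negBr B y) :=
  LinearMap.ext fun z => by
    simp [negBr_apply, B.assoc]

theorem commute_negBr (B : CommBracket A) (x y : A →₀ ℝ) : Commute (negBr B x) (negBr B y) :=
  LinearMap.ext fun z => by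
    simp only [Module.End.mul_apply, negBr_apply, map_neg, neg_neg]
    rw [← B.assoc, ← B.assoc, B.comm x]

/-- The operator `(-[a₁, ·]) ⋯ (-[aₙ, ·])` on `ℝ^A` of a word `a₁ ⋯ aₙ`. -/
def bracketOperator (B : CommBracket A) (w : List A) : Module.End ℝ (A →₀ ℝ) :=
  (w.map fun a => negBr B (letter a)).prod

/-- The linear extension of `bracketOperator` to `T(A)`. -/
abbrev bracketOperatorExt (B : CommBracket A) : Tensor A →ₗ[ℝ] Module.End ℝ (A →₀ ℝ) :=
  Finsupp.linearCombination ℝ (bracketOperator B)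

theorem bracketOperatorExt_word (B : CommBracket A) (w : List A) :
    bracketOperatorExt B (word w) = bracketOperator B w := by
  rw [bracketOperatorExt, Finsupp.linearCombination_single, one_smul]

theorem commute_bracketOperator (B : CommBracket A) (x : A →₀ ℝ) (w : List A) :
    Commute (negBr B x) (bracketOperator B w) := by
  refine Commute.list_prod_right _ _ fun y hy => ?_
  obtain ⟨a, -, rfl⟩ := List.mem_map.1 hy
  exact commute_negBr B x _

theorem bracketOperator_append_singleton (B : CommBracket A) (w : List A) (a : A) :
    bracketOperator B (w ++ [a]) = bracketOperator B w * negBr B (letter a) := by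
  simp [bracketOperator]

/-- A bilinear extension principle: two linear maps which agree on appended letters agree on
`snoc h x` for all `h` and `x`. -/
theorem map_snoc_ext {M : Type*} [AddCommMonoid M] [Module ℝ M] {F : Tensor A →ₗ[ℝ] M}
    {G : Tensor A →ₗ[ℝ] (A →₀ ℝ) →ₗ[ℝ] M}
    (hFG : ∀ w a, F (word (w ++ [a])) = G (word w) (letter a)) (h : Tensor A) (x : A →₀ ℝ) :
    F (snoc h x) = G h x := by
  have : snoc.compr₂ F = G := by
    refine Finsupp.lhom_ext' fun w => LinearMap.ext_ring (Finsupp.lhom_ext' fun a =>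
      LinearMap.ext_ring ?_)
    change F (snoc (word w) (letter a)) = G (word w) (letter a)
    rw [snoc_word_letter, hFG]
  exact congrArg (fun H : Tensor A →ₗ[ℝ] (A →₀ ℝ) →ₗ[ℝ] M => H h x) this

theorem bracketOperatorExt_snoc (B : CommBracket A) (h : Tensor A) (x : A →₀ ℝ) :
    bracketOperatorExt B (snoc h x) = bracketOperatorExt B h * negBr B x := by
  refine map_snoc_ext (G := (LinearMap.mul ℝ (Module.End ℝ (A →₀ ℝ))).compl₁₂
    (bracketOperatorExt B) (negBr B)) (fun w a => ?_) h x
  rw [LinearMap.compl₁₂_apply, LinearMap.mul_apply', bracketOperatorExt_word,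
    bracketOperatorExt_word, bracketOperator_append_singleton]

/-- The signed brackets of words are multiplicative for the quasi-shuffle product. -/
theorem bracketOperatorExt_quasiShuffle (B : CommBracket A) (u v : List A) :
    bracketOperatorExt B (quasiShuffle B (word u) (word v))
      = bracketOperator B u * bracketOperator B v := by
  induction u using List.reverseRecOn generalizing v with
  | nil =>
    rw [quasiShuffle_nil_left, bracketOperatorExt_word]
    simp [bracketOperator]
  | append_singleton u a ihu =>
  induction v using List.reverseRecOn with
  | nil =>
    rw [quasiShuffle_nil_right, bracketOperatorExt_word]
    simp [bracketOperator]
  | append_singleton v b ihv =>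
  rw [quasiShuffle_append_append, map_add, map_add, bracketOperatorExt_snoc,
    bracketOperatorExt_snoc, bracketOperatorExt_snoc, ihu, ihu, ihv, negBr_br]
  simp only [bracketOperator_append_singleton, mul_smul_comm, mul_assoc]
  rw [(commute_negBr B (letter b) (letter a)).eq]
  module

/-- The linear map `ℝ^A → ℝ^A` which multiplies each letter by its weight. -/
def letterGrading (ω : A → ℕ) : Module.End ℝ (A →₀ ℝ) :=
  Finsupp.linearCombination ℝ fun a => (ω a : ℝ) • letter a

theorem letterGrading_letter (ω : A → ℕ) (a : A) :
    letterGrading ω (letter a) = (ω a : ℝ) • letter a := by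
  simp [letterGrading]

theorem letterGrading_of_mem {ω : A → ℕ} {k : ℕ} {x : A →₀ ℝ} (hx : x ∈ letterSpace ω k) :
    letterGrading ω x = (k : ℝ) • x := by
  rw [letterSpace] at hx
  induction hx using Submodule.span_induction with
  | mem y hy =>
    obtain ⟨a, ha, rfl⟩ := hy
    rw [letterGrading_letter, show ω a = k from ha]
  | zero => simp
  | add y z _ _ hy hz => rw [map_add, hy, hz, smul_add]
  | smul r y _ hy => rw [map_smul, hy, smul_comm]

/-- The element `(-1)^(n-1) ω(aₙ) [a₁, …, aₙ]` of `ℝ^A` of a word `a₁ ⋯ aₙ`. -/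
def signedBracket (B : CommBracket A) (ω : A → ℕ) : List A → A →₀ ℝ
  | [] => 0
  | [a] => (ω a : ℝ) • letter a
  | a :: b :: w => -B.br (letter a) (signedBracket B ω (b :: w))

theorem signedBracket_append_singleton (B : CommBracket A) (ω : A → ℕ) (w : List A) (a : A) :
    signedBracket B ω (w ++ [a]) = bracketOperator B w (letterGrading ω (letter a)) := by
  induction w with
  | nil => simp [signedBracket, bracketOperator, letterGrading]
  | cons b w ih =>
    have h : signedBracket B ω (b :: (w ++ [a]))
        = -B.br (letter b) (signedBracket B ω (w ++ [a])) := by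
      obtain ⟨c, l, hl⟩ := List.exists_cons_of_ne_nil (List.append_ne_nil_of_right_ne_nil w
        (List.cons_ne_nil a []))
      rw [hl, signedBracket]
    have h' : bracketOperator B (b :: w) = negBr B (letter b) * bracketOperator B w := by
      simp [bracketOperator]
    rw [List.cons_append, h, ih, h', Module.End.mul_apply, negBr_apply]

/-- The linear extension of `signedBracket` to `T(A)`. -/
abbrev signedBracketExt (B : CommBracket A) (ω : A → ℕ) : Tensor A →ₗ[ℝ] A →₀ ℝ :=
  Finsupp.linearCombination ℝ (signedBracket B ω)

theorem signedBracketExt_snoc (B : CommBracket A) (ω : A → ℕ) (h : Tensor A) (x : A →₀ ℝ) :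
    signedBracketExt B ω (snoc h x) = bracketOperatorExt B h (letterGrading ω x) := by
  refine map_snoc_ext (G := (bracketOperatorExt B).compl₂ (letterGrading ω)) (fun w a => ?_) h x
  rw [LinearMap.compl₂_apply, bracketOperatorExt_word, ← signedBracket_append_singleton]
  simp [signedBracketExt]

/-- The signed brackets vanish at products, since `letterGrading` is a derivation of the bracket. -/
theorem signedBracketExt_quasiShuffle {B : CommBracket A} {ω : A → ℕ}
    (hω : IsIntrinsicWeight B ω) {u v : List A} (hu : u ≠ []) (hv : v ≠ []) :
    signedBracketExt B ω (quasiShuffle B (word u) (word v)) = 0 := by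
  obtain ⟨u, a, rfl⟩ := (List.eq_nil_or_concat' u).resolve_left hu
  obtain ⟨v, b, rfl⟩ := (List.eq_nil_or_concat' v).resolve_left hv
  rw [quasiShuffle_append_append, map_add, map_add, signedBracketExt_snoc, signedBracketExt_snoc,
    signedBracketExt_snoc, bracketOperatorExt_quasiShuffle, bracketOperatorExt_quasiShuffle,
    bracketOperatorExt_quasiShuffle, letterGrading_of_mem (br_letter_mem hω a b),
    letterGrading_letter, letterGrading_letter, bracketOperator_append_singleton,
    bracketOperator_append_singleton, mul_assoc, (commute_bracketOperator B (letter a) v).eq]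
  simp only [Module.End.mul_apply, map_smul, negBr_apply, B.comm (letter b) (letter a), map_neg]
  push_cast
  module

/-- The infinitesimal character that comes from the signed brackets; its value at a letter `a` is
`ω a * f a`. -/
def letterFunctional (B : CommBracket A) (ω : A → ℕ) (f : A → ℝ) (w : List A) : ℝ :=
  Finsupp.linearCombination ℝ f (signedBracket B ω w)

theorem letterFunctional_quasiShuffle {B : CommBracket A} {ω : A → ℕ}
    (hω : IsIntrinsicWeight B ω) (f : A → ℝ) (u v : List A) (hu : u ≠ []) (hv : v ≠ []) :
    linExt (letterFunctional B ω f) (quasiShuffle B (word u) (word v)) = 0 := by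
  have : linExt (letterFunctional B ω f)
      = (Finsupp.linearCombination ℝ f : (A →₀ ℝ) →ₗ[ℝ] ℝ) ∘ₗ signedBracketExt B ω :=
    Finsupp.lhom_ext' fun w => LinearMap.ext_ring (by simp [letterFunctional])
  rw [this, LinearMap.comp_apply, signedBracketExt_quasiShuffle hω hu hv, map_zero]

theorem letterFunctional_singleton (B : CommBracket A) (ω : A → ℕ) (f : A → ℝ) (a : A) :
    letterFunctional B ω f [a] = ω a * f a := by
  simp [letterFunctional, signedBracket]

end Letters

/-! ### Extension of rough paths by one weight -/

section Holder

variable {T : ℝ}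

/-- `F s t = O(|t - s| ^ p)`, including the times `s = t`. -/
def HolderBound (p : ℝ) (F : Set.Icc 0 T → Set.Icc 0 T → ℝ) : Prop :=
  ∃ C, 0 ≤ C ∧ ∀ s t, |F s t| ≤ C * |(t : ℝ) - s| ^ p

theorem HolderBound.of_ne {p : ℝ} {F : Set.Icc 0 T → Set.Icc 0 T → ℝ} (h0 : ∀ s, F s s = 0)
    (h : ∃ C, ∀ s t, s ≠ t → |F s t| ≤ C * |(t : ℝ) - s| ^ p) : HolderBound p F := by
  obtain ⟨C, hC⟩ := h
  refine ⟨|C|, abs_nonneg _, fun s t => ?_⟩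
  by_cases hst : s = t
  · subst hst
    rw [h0, abs_zero]
    positivity
  · exact (hC s t hst).trans (by gcongr; exact le_abs_self C)

theorem HolderBound.zero {p : ℝ} : HolderBound p (fun _ _ : Set.Icc 0 T => 0) :=
  ⟨0, le_rfl, by simp⟩

theorem HolderBound.add {p : ℝ} {F G : Set.Icc 0 T → Set.Icc 0 T → ℝ} (hF : HolderBound p F)
    (hG : HolderBound p G) : HolderBound p (fun s t => F s t + G s t) := by
  obtain ⟨C, hC0, hC⟩ := hF
  obtain ⟨D, hD0, hD⟩ := hG
  exact ⟨C + D, add_nonneg hC0 hD0, fun s t =>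
    (abs_add_le _ _).trans ((add_le_add (hC s t) (hD s t)).trans_eq (add_mul _ _ _).symm)⟩

theorem HolderBound.const_mul {p : ℝ} {F : Set.Icc 0 T → Set.Icc 0 T → ℝ} (hF : HolderBound p F)
    (c : ℝ) : HolderBound p (fun s t => c * F s t) := by
  obtain ⟨C, hC0, hC⟩ := hF
  refine ⟨|c| * C, by positivity, fun s t => ?_⟩
  rw [abs_mul, mul_assoc]
  exact mul_le_mul_of_nonneg_left (hC s t) (abs_nonneg c)

theorem HolderBound.sum {ι : Type*} {p : ℝ} (S : Finset ι)
    {F : ι → Set.Icc 0 T → Set.Icc 0 T → ℝ} (hF : ∀ i ∈ S, HolderBound p (F i)) :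
    HolderBound p (fun s t => ∑ i ∈ S, F i s t) := by
  classical
  induction S using Finset.induction_on with
  | empty => simpa using HolderBound.zero
  | insert i S hi ih =>
    simp only [Finset.sum_insert hi]
    exact (hF i (Finset.mem_insert_self i S)).add
      (ih fun j hj => hF j (Finset.mem_insert_of_mem hj))

theorem HolderBound.mul {p q : ℝ} (hp : 0 ≤ p) (hq : 0 ≤ q)
    {F G : Set.Icc 0 T → Set.Icc 0 T → ℝ} (hF : HolderBound p F) (hG : HolderBound q G) :
    HolderBound (p + q) (fun s t => F s t * G s t) := by
  obtain ⟨C, hC0, hC⟩ := hF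
  obtain ⟨D, hD0, hD⟩ := hG
  refine ⟨C * D, by positivity, fun s t => ?_⟩
  rw [abs_mul, Real.rpow_add_of_nonneg (abs_nonneg _) hp hq]
  calc _ ≤ (C * |(t : ℝ) - s| ^ p) * (D * |(t : ℝ) - s| ^ q) :=
        mul_le_mul (hC s t) (hD s t) (abs_nonneg _) (by positivity)
    _ = _ := by ring

variable {A : Type*} {ω : A → ℕ} {γ : ℝ}

theorem HolderBound.wordConv (hγ : 0 ≤ γ) {F G : Set.Icc 0 T → Set.Icc 0 T → List A → ℝ}
    {w : List A}
    (h : ∀ i ≤ w.length, HolderBound (γ * wordWeight ω (w.take i)) (fun s t => F s t (w.take i)) ∧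
      HolderBound (γ * wordWeight ω (w.drop i)) (fun s t => G s t (w.drop i))) :
    HolderBound (γ * wordWeight ω w) (fun s t => QuasiGeom.wordConv (F s t) (G s t) w) := by
  refine HolderBound.sum _ fun i hi => ?_
  obtain ⟨h1, h2⟩ := h i (Nat.lt_succ_iff.1 (Finset.mem_range.1 hi))
  have := h1.mul (by positivity) (by positivity) h2
  rwa [← mul_add, ← Nat.cast_add, wordWeight_take_add_drop] at this

/-- Bound for a convolution over adjacent, not necessarily ordered, intervals. -/
theorem exists_abs_wordConv_le (hγ : 0 ≤ γ) {F : Set.Icc 0 T → Set.Icc 0 T → List A → ℝ}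
    {w : List A}
    (h : ∀ i ≤ w.length, HolderBound (γ * wordWeight ω (w.take i)) (fun s t => F s t (w.take i)) ∧
      HolderBound (γ * wordWeight ω (w.drop i)) (fun s t => F s t (w.drop i))) :
    ∃ C, 0 ≤ C ∧ ∀ s u t : Set.Icc 0 T, |wordConv (F s u) (F u t) w|
      ≤ C * (|(u : ℝ) - s| + |(t : ℝ) - u|) ^ (γ * wordWeight ω w) := by
  have key : ∀ i : ℕ, ∃ C, 0 ≤ C ∧ (i ≤ w.length → ∀ s u t : Set.Icc 0 T,
      |F s u (w.take i) * F u t (w.drop i)|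
        ≤ C * (|(u : ℝ) - s| + |(t : ℝ) - u|) ^ (γ * wordWeight ω w)) := by
    intro i
    by_cases hi : i ≤ w.length
    · obtain ⟨⟨C, hC0, hC⟩, ⟨D, hD0, hD⟩⟩ := h i hi
      refine ⟨C * D, by positivity, fun _ s u t => ?_⟩
      have e : γ * wordWeight ω w
          = γ * wordWeight ω (w.take i) + γ * wordWeight ω (w.drop i) := by
        rw [← mul_add, ← Nat.cast_add, wordWeight_take_add_drop]
      rw [e, Real.rpow_add_of_nonneg (by positivity) (by positivity) (by positivity), abs_mul]
      calc _ ≤ (C * |(u : ℝ) - s| ^ (γ * wordWeight ω (w.take i)))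
            * (D * |(t : ℝ) - u| ^ (γ * wordWeight ω (w.drop i))) :=
            mul_le_mul (hC s u) (hD u t) (abs_nonneg _) (by positivity)
        _ ≤ (C * (|(u : ℝ) - s| + |(t : ℝ) - u|) ^ (γ * wordWeight ω (w.take i)))
            * (D * (|(u : ℝ) - s| + |(t : ℝ) - u|) ^ (γ * wordWeight ω (w.drop i))) := by
          gcongr
          · exact le_add_of_nonneg_right (abs_nonneg _)
          · exact le_add_of_nonneg_left (abs_nonneg _)
        _ = _ := by ring
    · exact ⟨0, le_rfl, fun h => absurd h hi⟩
  choose C hC0 hC using key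
  refine ⟨∑ i ∈ Finset.range (w.length + 1), C i, Finset.sum_nonneg fun i _ => hC0 i,
    fun s u t => ?_⟩
  rw [Finset.sum_mul]
  exact (Finset.abs_sum_le_sum_abs _ _).trans (Finset.sum_le_sum fun i hi =>
    hC i (Nat.lt_succ_iff.1 (Finset.mem_range.1 hi)) s u t)

end Holder

section Perturbation

variable {A : Type*} {B : CommBracket A} {ω : A → ℕ}

theorem wordConv_congr {f f' g g' : List A → ℝ} {w : List A}
    (hf : ∀ v, wordWeight ω v ≤ wordWeight ω w → f v = f' v)
    (hg : ∀ v, wordWeight ω v ≤ wordWeight ω w → g v = g' v) :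
    wordConv f g w = wordConv f' g' w :=
  Finset.sum_congr rfl fun i _ => by
    rw [hf _ (wordWeight_take_le ω w i), hg _ (wordWeight_drop_le ω w i)]

theorem wordConv_perturb_left (hω : IsIntrinsicWeight B ω) {f f' g : List A → ℝ} (hg : g [] = 1)
    {w : List A} (hf : ∀ v, wordWeight ω v < wordWeight ω w → f' v = f v) :
    wordConv f' g w = wordConv f g w + (f' w - f w) := by
  rw [wordConv, wordConv, Finset.sum_range_succ, Finset.sum_range_succ, List.take_length,
    List.drop_length, hg, Finset.sum_congr rfl fun i hi => by
      rw [hf _ (wordWeight_take_lt hω (Finset.mem_range.1 hi))]]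
  ring

theorem wordConv_perturb_right (hω : IsIntrinsicWeight B ω) {f g g' : List A → ℝ} (hf : f [] = 1)
    {w : List A} (hw : w ≠ []) (hg : ∀ v, wordWeight ω v < wordWeight ω w → g' v = g v) :
    wordConv f g' w = wordConv f g w + (g' w - g w) := by
  rw [wordConv, wordConv, Finset.sum_range_succ', Finset.sum_range_succ', List.take_zero,
    List.drop_zero, hf, Finset.sum_congr rfl fun i _ => by
      rw [hg _ (wordWeight_drop_lt hω hw (Nat.succ_pos i))]]
  ring

/-- The convolution of two characters is a character. -/
theorem IsTruncatedCharacter.linExt_wordConv {n : ℕ} {f g : List A → ℝ}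
    (hf : IsTruncatedCharacter B ω n f) (hg : IsTruncatedCharacter B ω n g) {u v : List A}
    (huv : wordWeight ω u + wordWeight ω v ≤ n) :
    linExt (wordConv f g) (quasiShuffle B (word u) (word v))
      = wordConv f g u * wordConv f g v := by
  rw [← conv_linExt, conv_quasiShuffle, wordConv, wordConv, Finset.sum_mul_sum]
  refine Finset.sum_congr rfl fun i _ => Finset.sum_congr rfl fun j _ => ?_
  have := wordWeight_take_le ω u i
  have := wordWeight_take_le ω v j
  have := wordWeight_drop_le ω u i
  have := wordWeight_drop_le ω v j
  rw [hf.mul _ _ (by omega), hg.mul _ _ (by omega)]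
  ring

theorem IsTruncatedCharacter.congr (hω : IsIntrinsicWeight B ω) {n : ℕ} {f g : List A → ℝ}
    (hf : IsTruncatedCharacter B ω n f) (hfg : ∀ w, wordWeight ω w ≤ n → g w = f w) :
    IsTruncatedCharacter B ω n g := by
  refine ⟨by rw [hfg [] (by simp [wordWeight_nil]), hf.nil], fun u v huv => ?_⟩
  rw [hfg u (by omega), hfg v (by omega), ← hf.mul u v huv]
  exact linExt_congr (fun w hw => hfg w (by omega)) (quasiShuffle_mem_weightSpace hω u v)

theorem linExt_add (f g : List A → ℝ) (h : Tensor A) :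
    linExt (f + g) h = linExt f h + linExt g h := by
  simp [linExt, Finsupp.linearCombination_apply, Finsupp.sum, mul_add, Finset.sum_add_distrib]

theorem linExt_smul (c : ℝ) (f : List A → ℝ) (h : Tensor A) :
    linExt (c • f) h = c * linExt f h := by
  simp [linExt, Finsupp.linearCombination_apply, Finsupp.sum, Finset.mul_sum, mul_left_comm]

/-- The functions on words which vanish at letters and whose linear extensions vanish at the
products of total weight `m` of nonempty words. -/
def infinitesimalSpace (B : CommBracket A) (ω : A → ℕ) (m : ℕ) : Submodule ℝ (List A → ℝ) where
  carrier := {z | (∀ a, z [a] = 0) ∧ ∀ u v, u ≠ [] → v ≠ [] → wordWeight ω u + wordWeight ω v = m →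
    linExt z (quasiShuffle B (word u) (word v)) = 0}
  add_mem' := fun {y z} hy hz => ⟨fun a => by rw [Pi.add_apply, hy.1, hz.1, add_zero],
    fun u v hu hv h => by rw [linExt_add, hy.2 u v hu hv h, hz.2 u v hu hv h, add_zero]⟩
  zero_mem' := ⟨fun _ => rfl, fun u v _ _ _ => by
    simp [linExt]⟩
  smul_mem' := fun c z hz => ⟨fun a => by rw [Pi.smul_apply, hz.1, smul_zero],
    fun u v hu hv h => by rw [linExt_smul, hz.2 u v hu hv h, mul_zero]⟩

/-- Extension by zero of a function on the words of weight `m`. -/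
abbrev extendWords (ω : A → ℕ) (m : ℕ) :
    ({w : List A | wordWeight ω w = m} → ℝ) →ₗ[ℝ] List A → ℝ :=
  Function.ExtendByZero.linearMap ℝ Subtype.val

theorem extendWords_of_eq {m : ℕ} (z : {w : List A | wordWeight ω w = m} → ℝ) {w : List A}
    (hw : wordWeight ω w = m) : extendWords ω m z w = z ⟨w, hw⟩ :=
  Subtype.val_injective.extend_apply z 0 (⟨w, hw⟩ : {w : List A | wordWeight ω w = m})

theorem extendWords_of_ne {m : ℕ} (z : {w : List A | wordWeight ω w = m} → ℝ) {w : List A}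
    (hw : wordWeight ω w ≠ m) : extendWords ω m z w = 0 :=
  Function.extend_apply' (f := Subtype.val) z (0 : List A → ℝ) w
    fun ⟨v, hv⟩ => hw (hv ▸ v.2)

end Perturbation

section Step

variable {A : Type*} {B : CommBracket A} {ω : A → ℕ} {γ T : ℝ}

/-- A family of functions on words which has the properties of a `γ`-weighted rough path on the
words of weight at most `n`; its values on other words are irrelevant. -/
structure IsPartialRoughPath (B : CommBracket A) (ω : A → ℕ) (γ : ℝ) {T : ℝ} (n : ℕ)
    (X : Set.Icc 0 T → Set.Icc 0 T → List A → ℝ) : Prop where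
  char : ∀ s t, IsTruncatedCharacter B ω n (X s t)
  chen : ∀ s u t w, wordWeight ω w ≤ n → wordConv (X s u) (X u t) w = X s t w
  holder : ∀ w, wordWeight ω w ≤ n → HolderBound (γ * wordWeight ω w) (fun s t => X s t w)

theorem IsPartialRoughPath.congr (hω : IsIntrinsicWeight B ω) {n : ℕ}
    {X X' : Set.Icc 0 T → Set.Icc 0 T → List A → ℝ} (hX : IsPartialRoughPath B ω γ n X)
    (h : ∀ s t w, wordWeight ω w ≤ n → X' s t w = X s t w) : IsPartialRoughPath B ω γ n X' where
  char s t := (hX.char s t).congr hω (h s t)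
  chen s u t w hw := by
    rw [h s t w hw, ← hX.chen s u t w hw]
    exact wordConv_congr (ω := ω) (fun v hv => h s u v (hv.trans hw))
      (fun v hv => h u t v (hv.trans hw))
  holder w hw := by simpa only [h _ _ w hw] using hX.holder w hw

/-- If no word has weight `n + 1`, nothing has to be extended. -/
theorem IsPartialRoughPath.succ_of_forall_ne {n : ℕ}
    {X : Set.Icc 0 T → Set.Icc 0 T → List A → ℝ} (hX : IsPartialRoughPath B ω γ n X)
    (hn : ∀ w : List A, wordWeight ω w ≠ n + 1) : IsPartialRoughPath B ω γ (n + 1) X where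
  char s t := ⟨(hX.char s t).nil, fun u v huv => (hX.char s t).mul u v <| by
    have := hn (u ++ v)
    rw [wordWeight_append] at this
    omega⟩
  chen s u t w hw := hX.chen s u t w (by have := hn w; omega)
  holder w hw := hX.holder w (by have := hn w; omega)

theorem IsPartialRoughPath.holder_dynkin (hγ : 0 ≤ γ) {n : ℕ}
    {X : Set.Icc 0 T → Set.Icc 0 T → List A → ℝ} (hX : IsPartialRoughPath B ω γ n X)
    (w : List A) (hw : wordWeight ω w ≤ n) :
    HolderBound (γ * wordWeight ω w) (fun s t => dynkin ω (X s t) w) := by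
  induction hk : w.length using Nat.strong_induction_on generalizing w with
  | _ k ih =>
  subst hk
  cases w with
  | nil => simpa only [dynkin_nil] using HolderBound.zero
  | cons a w =>
    simp only [dynkin_cons, sub_eq_add_neg]
    refine ((hX.holder _ hw).const_mul _).add ?_
    have : HolderBound (γ * wordWeight ω (a :: w)) (fun s t =>
        ∑ i ∈ Finset.range (w.length + 1),
          X s t (a :: w.take i) * dynkin ω (X s t) (w.drop i)) := by
      refine HolderBound.sum _ fun i _ => ?_
      have e := wordWeight_take_add_drop ω (a :: w) (i + 1)
      rw [List.take_succ_cons, List.drop_succ_cons] at e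
      have h1 := hX.holder (a :: w.take i) (by omega)
      have h2 := ih (w.drop i).length (by simp only [List.length_drop, List.length_cons]; omega)
        (w.drop i) (by omega) rfl
      have h3 := h1.mul (by positivity) (by positivity) h2
      rwa [← mul_add, ← Nat.cast_add, e] at h3
    simpa only [neg_one_mul] using this.const_mul (-1)

theorem holder_letterFunctional (B : CommBracket A) (ω : A → ℕ) {p : ℝ}
    {f : Set.Icc 0 T → Set.Icc 0 T → A → ℝ} (hf : ∀ a, HolderBound p (fun s t => f s t a))
    (w : List A) : HolderBound p (fun s t => letterFunctional B ω (f s t) w) := by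
  simp only [letterFunctional, Finsupp.linearCombination_apply, Finsupp.sum, smul_eq_mul]
  exact HolderBound.sum _ fun a _ => (hf a).const_mul _

theorem dynkinExtension_singleton (B : CommBracket A) (f : A → ℝ) {m : ℕ} (hm : m ≠ 0)
    {g : List A → ℝ} (hg : g [] = 1) {a : A} (ha : ω a = m) :
    dynkinExtension ω m (letterFunctional B ω f) g [a] = f a := by
  have hw : wordWeight ω [a] = m := by rw [wordWeight_cons, wordWeight_nil, ha, add_zero]
  have h0 : wordWeight ω ([] : List A) ≠ m := by rw [wordWeight_nil]; exact hm.symm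
  rw [dynkinExtension, if_pos hw, wordConv_cons, wordConv_nil, hg, dynkinWith, dynkinWith,
    if_pos hw, if_neg h0, dynkin_nil, letterFunctional_singleton, ha]
  field_simp
  ring

/-- The canonical extension of a rough path by one weight: all its properties but Chen's identity
hold also for the new words. -/
theorem IsPartialRoughPath.exists_dynkinExtension (hω : IsIntrinsicWeight B ω) (hγ : 0 ≤ γ)
    {n : ℕ} {X : Set.Icc 0 T → Set.Icc 0 T → List A → ℝ} (hX : IsPartialRoughPath B ω γ n X)
    {x : Set.Icc 0 T → A → ℝ}
    (hx : ∀ a, ω a = n + 1 → HolderBound (γ * ω a) (fun s t => x t a - x s a)) :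
    ∃ Y : Set.Icc 0 T → Set.Icc 0 T → List A → ℝ,
      (∀ s t, IsTruncatedCharacter B ω (n + 1) (Y s t)) ∧
      (∀ w, wordWeight ω w ≤ n + 1 → HolderBound (γ * wordWeight ω w) (fun s t => Y s t w)) ∧
      (∀ s t w, wordWeight ω w ≤ n → Y s t w = X s t w) ∧
      ∀ a, ω a = n + 1 → ∀ s t, Y s t [a] = x t a - x s a := by
  let f : Set.Icc 0 T → Set.Icc 0 T → A → ℝ := fun s t a =>
    if ω a = n + 1 then x t a - x s a else 0
  have hf : ∀ a, HolderBound (γ * (n + 1 : ℕ)) (fun s t => f s t a) := by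
    intro a
    by_cases ha : ω a = n + 1
    · simpa only [f, if_pos ha, ha] using hx a ha
    · simpa only [f, if_neg ha] using HolderBound.zero
  have hlow : ∀ s t w, wordWeight ω w ≤ n →
      dynkinExtension ω (n + 1) (letterFunctional B ω (f s t)) (X s t) w = X s t w :=
    fun s t w hw => by rw [dynkinExtension, if_neg (by omega)]
  refine ⟨fun s t => dynkinExtension ω (n + 1) (letterFunctional B ω (f s t)) (X s t),
    fun s t => (hX.char s t).dynkinExtension hω (letterFunctional_quasiShuffle hω _),
    fun w hw => ?_, hlow, fun a ha s t => ?_⟩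
  · rcases Nat.lt_or_ge n (wordWeight ω w) with h | h
    swap
    · simpa only [hlow _ _ w h] using hX.holder w h
    have hw' : wordWeight ω w = n + 1 := by omega
    simp only [dynkinExtension, if_pos hw']
    refine HolderBound.const_mul ?_ _
    have hμ : ∀ i, HolderBound (γ * wordWeight ω (w.drop i)) (fun s t =>
        dynkinWith ω (n + 1) (letterFunctional B ω (f s t)) (X s t) (w.drop i)) := by
      intro i
      by_cases hi : wordWeight ω (w.drop i) = n + 1
      · simp only [dynkinWith, if_pos hi]
        rw [hi]
        exact holder_letterFunctional B ω hf _
      · simp only [dynkinWith, if_neg hi]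
        exact hX.holder_dynkin hγ _ (by have := wordWeight_drop_le ω w i; omega)
    -- the last term of the convolution involves a value of `X` at weight `n + 1`, but vanishes
    have e : ∀ s t, wordConv (X s t)
        (dynkinWith ω (n + 1) (letterFunctional B ω (f s t)) (X s t)) w
        = ∑ i ∈ Finset.range w.length, X s t (w.take i) *
          dynkinWith ω (n + 1) (letterFunctional B ω (f s t)) (X s t) (w.drop i) := by
      intro s t
      rw [wordConv, Finset.sum_range_succ, List.drop_length, dynkinWith,
        if_neg (by rw [wordWeight_nil]; omega), dynkin_nil, mul_zero, add_zero]
    simp only [e]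
    refine HolderBound.sum _ fun i hi => ?_
    have := wordWeight_take_lt hω (Finset.mem_range.1 hi)
    have h3 := (hX.holder (w.take i) (by omega)).mul (by positivity) (by positivity) (hμ i)
    rwa [← mul_add, ← Nat.cast_add, wordWeight_take_add_drop] at h3
  · beta_reduce
    rw [dynkinExtension_singleton B _ (by omega) (hX.char s t).nil ha]
    exact if_pos ha

end Step

section Correction

variable {A : Type*} {B : CommBracket A} {ω : A → ℕ} {γ T : ℝ}

/-- A rough path extends by one weight, with prescribed increments at the new letters. Its canonical
extension may violate Chen's identity at weight `n + 1`; the defect is an additive cocycle with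
values in a finite-dimensional space of functionals vanishing at products and letters, and the
sewing lemma writes it as a coboundary, which is the correction. -/
theorem IsPartialRoughPath.exists_succ [Finite A] (hω : IsIntrinsicWeight B ω) (hγ : 0 < γ)
    (hT : 0 < T) {n : ℕ} (hn : γ * (n + 1 : ℕ) ≠ 1)
    {X : Set.Icc 0 T → Set.Icc 0 T → List A → ℝ} (hX : IsPartialRoughPath B ω γ n X)
    {x : Set.Icc 0 T → A → ℝ}
    (hx : ∀ a, ω a = n + 1 → HolderBound (γ * ω a) (fun s t => x t a - x s a)) :
    ∃ X' : Set.Icc 0 T → Set.Icc 0 T → List A → ℝ, IsPartialRoughPath B ω γ (n + 1) X' ∧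
      (∀ s t w, wordWeight ω w ≤ n → X' s t w = X s t w) ∧
      ∀ a, ω a = n + 1 → ∀ s t, X' s t [a] = x t a - x s a := by
  obtain ⟨Y, hYchar, hYholder, hYX, hYx⟩ := hX.exists_dynkinExtension hω hγ.le hx
  set m := n + 1 with hm
  have hθ : 0 < γ * (m : ℕ) := by positivity
  have hYchen : ∀ s u t w, wordWeight ω w ≤ n → wordConv (Y s u) (Y u t) w = Y s t w := by
    intro s u t w hw
    rw [hYX s t w hw, ← hX.chen s u t w hw]
    exact wordConv_congr (ω := ω) (fun v hv => hYX s u v (hv.trans hw))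
      (fun v hv => hYX u t v (hv.trans hw))
  have hne : ∀ w : List A, wordWeight ω w = m → w ≠ [] := by
    rintro w hw rfl
    rw [wordWeight_nil] at hw
    omega
  -- the defect of Chen's identity
  let D : Set.Icc 0 T → Set.Icc 0 T → Set.Icc 0 T → List A → ℝ := fun s u t w =>
    wordConv (Y s u) (Y u t) w - Y s t w
  have hcocycle : ∀ r s u t w, wordWeight ω w = m →
      D s u t w = D r u t w + D r s u w - D r s t w := by
    intro r s u t w hw
    have h1 := wordConv_perturb_left hω (hYchar u t).nil (f := Y r u)
      (f' := wordConv (Y r s) (Y s u)) (w := w) (fun v hv => hYchen r s u v (by omega))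
    have h2 := wordConv_perturb_right hω (hYchar r s).nil (g := Y s t)
      (g' := wordConv (Y s u) (Y u t)) (hne w hw) (fun v hv => hYchen s u t v (by omega))
    rw [wordConv_assoc] at h1
    simp only [D]
    linarith
  have hfin : Finite {w : List A | wordWeight ω w = m} :=
    (finite_setOf_wordWeight_eq hω m).to_subtype
  have : Fintype {w : List A | wordWeight ω w = m} := Fintype.ofFinite _
  let Z : Submodule ℝ ({w : List A | wordWeight ω w = m} → ℝ) :=
    (infinitesimalSpace B ω m).comap (extendWords ω m)
  have hDmem : ∀ s u t, (fun w => D s u t w.1 : {w : List A | wordWeight ω w = m} → ℝ) ∈ Z := by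
    intro s u t
    refine ⟨fun a => ?_, fun u' v' hu' hv' huv => ?_⟩
    · by_cases ha : wordWeight ω [a] = m
      · have ha' : ω a = m := by rwa [wordWeight_cons, wordWeight_nil, add_zero] at ha
        rw [extendWords_of_eq _ ha]
        simp only [D]
        rw [wordConv_cons, wordConv_nil, (hYchar s u).nil, (hYchar u t).nil, hYx a ha', hYx a ha',
          hYx a ha']
        ring
      · exact extendWords_of_ne _ ha
    · have pu := wordWeight_pos hω hu'
      have pv := wordWeight_pos hω hv'
      have e : linExt (wordConv (Y s u) (Y u t)) (quasiShuffle B (word u') (word v'))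
          = linExt (extendWords ω m (fun w => D s u t w.1) + Y s t)
            (quasiShuffle B (word u') (word v')) := by
        refine linExt_congr (fun w hw => ?_) (quasiShuffle_mem_weightSpace hω u' v')
        rw [Pi.add_apply, extendWords_of_eq _ (hw.trans huv)]
        simp [D]
      rw [linExt_add, (hYchar s u).linExt_wordConv (hYchar u t) huv.le,
        hYchen s u t u' (by omega), hYchen s u t v' (by omega),
        (hYchar s t).mul u' v' huv.le] at e
      linarith
  let DZ : Set.Icc 0 T → Set.Icc 0 T → Set.Icc 0 T → Z := fun s u t => ⟨_, hDmem s u t⟩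
  have hDbound : ∃ C, 0 ≤ C ∧ ∀ s u t : Set.Icc 0 T,
      ‖DZ s u t‖ ≤ C * (|(u : ℝ) - s| + |(t : ℝ) - u|) ^ (γ * (m : ℕ)) := by
    have hw : ∀ w : {w : List A | wordWeight ω w = m}, ∃ C, 0 ≤ C ∧ ∀ s u t : Set.Icc 0 T,
        |D s u t w.1| ≤ C * (|(u : ℝ) - s| + |(t : ℝ) - u|) ^ (γ * (m : ℕ)) := by
      rintro ⟨w, hw⟩
      change wordWeight ω w = m at hw
      obtain ⟨C1, hC1, h1⟩ := exists_abs_wordConv_le hγ.le (F := Y) (w := w) fun i _ =>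
        ⟨hYholder _ ((wordWeight_take_le ω w i).trans hw.le),
          hYholder _ ((wordWeight_drop_le ω w i).trans hw.le)⟩
      obtain ⟨C2, hC2, h2⟩ := hYholder w hw.le
      rw [hw] at h1 h2
      refine ⟨C1 + C2, by positivity, fun s u t => ?_⟩
      rw [add_mul]
      refine (abs_sub _ _).trans (add_le_add (h1 s u t) ((h2 s t).trans ?_))
      gcongr
      rw [add_comm]
      exact abs_sub_le _ _ _
    choose C hC0 hC using hw
    refine ⟨∑ w, C w, Finset.sum_nonneg fun w _ => hC0 w, fun s u t => ?_⟩
    refine (pi_norm_le_iff_of_nonneg (mul_nonneg (Finset.sum_nonneg fun w _ => hC0 w)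
      (by positivity))).2 fun w => (hC w s u t).trans ?_
    gcongr
    exact Finset.single_le_sum (fun w _ => hC0 w) (Finset.mem_univ w)
  obtain ⟨C, hC0, hC⟩ := hDbound
  -- the defect is closed, so that it is determined by its values with first time `0`
  have hcocycleZ : ∀ r s u t, DZ s u t = DZ r u t + DZ r s u - DZ r s t := fun r s u t =>
    Subtype.ext (funext fun w => hcocycle r s u t w.1 w.2)
  let o : Set.Icc 0 T := ⟨0, le_rfl, hT.le⟩
  obtain ⟨J, K, hJ⟩ := exists_sewing hT (A := DZ o) (C := C) hθ hn fun s u t hsu hut => by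
    have e : DZ o s t - DZ o s u - DZ o u t = -DZ s u t := by rw [hcocycleZ o s u t]; abel
    rw [e, norm_neg]
    refine (hC s u t).trans_eq ?_
    rw [abs_of_nonneg (sub_nonneg.2 (Subtype.coe_le_coe.2 hsu)),
      abs_of_nonneg (sub_nonneg.2 (Subtype.coe_le_coe.2 hut))]
    congr 2
    ring
  let z : Set.Icc 0 T → Set.Icc 0 T → Z := fun s t => J t - J s - DZ o s t
  have hz : ∀ s u t, z s t = z s u + z u t + DZ s u t := fun s u t => by
    rw [hcocycleZ o s u t]
    simp only [z]
    abel
  -- the bound for unordered times comes from `hz` for the loops `s, s, s` and `s, t, s`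
  have hzbound : ∃ C', 0 ≤ C' ∧ ∀ s t : Set.Icc 0 T,
      ‖z s t‖ ≤ C' * |(t : ℝ) - s| ^ (γ * (m : ℕ)) := by
    have hself : ∀ s, z s s = 0 := fun s => by
      have h1 : DZ s s s = 0 := by
        rw [← norm_le_zero_iff]
        refine (hC s s s).trans_eq ?_
        rw [sub_self, abs_zero, add_zero, Real.zero_rpow hθ.ne', mul_zero]
      have h2 := hz s s s
      rw [h1, add_zero] at h2
      exact left_eq_add.1 h2
    have hlt : ∀ s t : Set.Icc 0 T, s < t → ‖z s t‖ ≤ |K| * |(t : ℝ) - s| ^ (γ * (m : ℕ)) := by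
      intro s t hst
      have hst' : (0 : ℝ) ≤ t - s := sub_nonneg.2 (Subtype.coe_le_coe.2 hst.le)
      refine (hJ s t hst).trans ?_
      rw [abs_of_nonneg hst']
      gcongr
      exact le_abs_self K
    refine ⟨|K| + C * 2 ^ (γ * (m : ℕ)), by positivity, fun s t => ?_⟩
    rcases lt_trichotomy s t with h | rfl | h
    · refine (hlt s t h).trans ?_
      gcongr
      exact le_add_of_nonneg_right (by positivity)
    · rw [hself, norm_zero]
      positivity
    · have e : z s t = -(z t s + DZ s t s) := by
        have := hz s t s
        rw [hself] at this
        rw [eq_neg_iff_add_eq_zero, ← add_assoc]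
        exact this.symm
      have h1 := hlt t s h
      have h2 := hC s t s
      rw [abs_sub_comm (s : ℝ) t, ← two_mul, Real.mul_rpow (by norm_num) (abs_nonneg _)] at h2
      rw [abs_sub_comm (s : ℝ) t] at h1
      rw [e, norm_neg, add_mul, mul_assoc C]
      exact (norm_add_le _ _).trans (add_le_add h1 h2)
  let X' : Set.Icc 0 T → Set.Icc 0 T → List A → ℝ := fun s t => extendWords ω m (z s t).1 + Y s t
  have hX'low : ∀ s t w, wordWeight ω w < m → X' s t w = Y s t w := fun s t w hw => by
    simp only [X', Pi.add_apply]
    rw [extendWords_of_ne _ hw.ne, zero_add]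
  have hX'm : ∀ s t w (hw : wordWeight ω w = m), X' s t w = (z s t).1 ⟨w, hw⟩ + Y s t w :=
    fun s t w hw => by
      simp only [X', Pi.add_apply]
      rw [extendWords_of_eq _ hw]
  have hX'nil : ∀ s t, X' s t [] = 1 := fun s t => by
    rw [hX'low s t [] (by rw [wordWeight_nil]; omega), (hYchar s t).nil]
  refine ⟨X', ⟨fun s t => ⟨hX'nil s t, fun u v huv => ?_⟩, fun s u t w hw => ?_, fun w hw => ?_⟩,
    fun s t w hw => (hX'low s t w (by omega)).trans (hYX s t w hw), fun a ha s t => ?_⟩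
  · by_cases hu : u = []
    · rw [hu, quasiShuffle_nil_left, linExt_word, hX'nil, one_mul]
    by_cases hv : v = []
    · rw [hv, quasiShuffle_nil_right, linExt_word, hX'nil, mul_one]
    have pu := wordWeight_pos hω hu
    have pv := wordWeight_pos hω hv
    rw [hX'low s t u (by omega), hX'low s t v (by omega), ← (hYchar s t).mul u v huv]
    rcases huv.lt_or_eq with h | h
    · exact linExt_congr (fun w hw => hX'low s t w (by omega)) (quasiShuffle_mem_weightSpace hω u v)
    · rw [linExt_add, (z s t).2.2 u v hu hv h, zero_add]
  · rcases hw.lt_or_eq with h | h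
    · rw [hX'low s t w h, ← hYchen s u t w (by omega)]
      exact wordConv_congr (ω := ω) (fun v hv => hX'low s u v (by omega))
        (fun v hv => hX'low u t v (by omega))
    · rw [wordConv_perturb_left hω (hX'nil u t) (f := Y s u)
        (fun v hv => hX'low s u v (by omega)),
        wordConv_perturb_right hω (hYchar s u).nil (g := Y u t) (hne w h)
          (fun v hv => hX'low u t v (by omega)), hX'm s u w h, hX'm u t w h, hX'm s t w h, hz s u t]
      simp only [DZ, D, Submodule.coe_add, Pi.add_apply]
      ring
  · rcases hw.lt_or_eq with h | h
    · simpa only [hX'low _ _ w h] using hYholder w hw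
    · simp only [hX'm _ _ w h]
      refine HolderBound.add ?_ (hYholder w hw)
      obtain ⟨C', hC'0, hC'⟩ := hzbound
      rw [h]
      exact ⟨C', hC'0, fun s t => (norm_le_pi_norm (z s t).1 ⟨w, h⟩).trans (hC' s t)⟩
  · have hw : wordWeight ω [a] = m := by rw [wordWeight_cons, wordWeight_nil, ha, add_zero]
    have h0 := (z s t).2.1 a
    rw [extendWords_of_eq _ hw] at h0
    rw [hX'm s t [a] hw, h0, zero_add, hYx a ha]

/-- Extension through all weights, avoiding only the weight `1 / γ`. -/
theorem IsPartialRoughPath.exists_forall [Finite A] (hω : IsIntrinsicWeight B ω) (hγ : 0 < γ)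
    (hT : 0 < T) {N : ℕ} (hN : ∀ w : List A, N < wordWeight ω w → γ * wordWeight ω w ≠ 1)
    {X : Set.Icc 0 T → Set.Icc 0 T → List A → ℝ} (hX : IsPartialRoughPath B ω γ N X)
    {x : Set.Icc 0 T → A → ℝ}
    (hx : ∀ a, HolderBound (γ * ω a) (fun s t => x t a - x s a)) :
    ∃ XX : Set.Icc 0 T → Set.Icc 0 T → List A → ℝ, (∀ n ≥ N, IsPartialRoughPath B ω γ n XX) ∧
      (∀ s t w, wordWeight ω w ≤ N → XX s t w = X s t w) ∧
      ∀ a, N < ω a → ∀ s t, XX s t [a] = x t a - x s a := by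
  have step : ∀ (k : ℕ) (Y : Set.Icc 0 T → Set.Icc 0 T → List A → ℝ),
      ∃ Y' : Set.Icc 0 T → Set.Icc 0 T → List A → ℝ, IsPartialRoughPath B ω γ (N + k) Y →
        IsPartialRoughPath B ω γ (N + (k + 1)) Y' ∧
        (∀ s t w, wordWeight ω w ≤ N + k → Y' s t w = Y s t w) ∧
        ∀ a, ω a = N + k + 1 → ∀ s t, Y' s t [a] = x t a - x s a := by
    intro k Y
    by_cases hY : IsPartialRoughPath B ω γ (N + k) Y
    · by_cases hw : ∃ w : List A, wordWeight ω w = N + k + 1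
      · obtain ⟨w, hw⟩ := hw
        have h1 : γ * (N + k + 1 : ℕ) ≠ 1 := by
          rw [← hw]
          exact hN w (by omega)
        obtain ⟨Y', h⟩ := hY.exists_succ hω hγ hT h1 fun a _ => hx a
        exact ⟨Y', fun _ => h⟩
      · push Not at hw
        refine ⟨Y, fun _ => ⟨hY.succ_of_forall_ne hw, fun _ _ _ _ => rfl, fun a ha => ?_⟩⟩
        exact absurd (by rw [wordWeight_cons, wordWeight_nil, ha, add_zero]) (hw [a])
    · exact ⟨Y, fun h => absurd h hY⟩
  choose F hF using step
  let S : ℕ → Set.Icc 0 T → Set.Icc 0 T → List A → ℝ := fun k => Nat.rec X F k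
  have hS : ∀ k, IsPartialRoughPath B ω γ (N + k) (S k) := by
    intro k
    induction k with
    | zero => exact hX
    | succ k ih => exact (hF k (S k) ih).1
  have hstep : ∀ k s t w, wordWeight ω w ≤ N + k → S (k + 1) s t w = S k s t w :=
    fun k => (hF k (S k) (hS k)).2.1
  have hstable : ∀ j k s t w, wordWeight ω w ≤ N + k → S (k + j) s t w = S k s t w := by
    intro j k s t w hw
    induction j with
    | zero => rfl
    | succ j ih => rw [← ih]; exact hstep (k + j) s t w (by omega)
  let XX : Set.Icc 0 T → Set.Icc 0 T → List A → ℝ := fun s t w => S (wordWeight ω w - N) s t w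
  have hXX : ∀ k s t w, wordWeight ω w ≤ N + k → XX s t w = S k s t w := by
    intro k s t w hw
    have h := hstable (k - (wordWeight ω w - N)) (wordWeight ω w - N) s t w (by omega)
    rw [show wordWeight ω w - N + (k - (wordWeight ω w - N)) = k by omega] at h
    exact h.symm
  refine ⟨XX, fun n hn => ?_, hXX 0, fun a ha s t => ?_⟩
  · obtain ⟨k, rfl⟩ := Nat.exists_eq_add_of_le hn
    exact (hS k).congr hω (hXX k)
  · obtain ⟨k, hk⟩ := Nat.exists_eq_add_of_lt ha
    have hw : wordWeight ω [a] = N + (k + 1) := by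
      rw [wordWeight_cons, wordWeight_nil, hk]; ring
    rw [hXX (k + 1) s t [a] hw.le]
    exact (hF k (S k) (hS k)).2.2 a hk s t

end Correction

/-! ### Rough paths on truncated tensors -/

section Truncated

variable {A : Type*} {B : CommBracket A} {ω : A → ℕ} {γ T : ℝ}

theorem quasiShuffle_mem_truncSpace (hω : IsIntrinsicWeight B ω) {N : ℕ} {u v : List A}
    (h : wordWeight ω u + wordWeight ω v ≤ N) :
    quasiShuffle B (word u) (word v) ∈ truncSpace ω N :=
  Finsupp.supported_mono (fun _ hw => (show _ = _ from hw).trans_le h)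
    (quasiShuffle_mem_weightSpace hω u v)

/-- A functional on the truncated tensors as a function on words, zero on the words of large
weight. -/
def truncValues {N : ℕ} (α : Module.Dual ℝ (truncSpace ω N)) (w : List A) : ℝ :=
  α (truncProj ω N (word w))

theorem truncValues_of_le {N : ℕ} (α : Module.Dual ℝ (truncSpace ω N)) {w : List A}
    (hw : wordWeight ω w ≤ N) : truncValues α w = α (truncWord w hw) := by
  rw [truncValues, truncProj_word w hw]

theorem linExt_truncValues {N : ℕ} (α : Module.Dual ℝ (truncSpace ω N)) (h : truncSpace ω N) :
    linExt (truncValues α) (h : Tensor A) = α h := by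
  have e : linExt (truncValues α) = α ∘ₗ truncProj ω N :=
    Finsupp.lhom_ext' fun w => LinearMap.ext_ring (by simp [truncValues])
  rw [e, LinearMap.comp_apply]
  exact congrArg α (LinearMap.congr_fun (Finsupp.restrictDom_comp_subtype _) h)

theorem truncConv_apply {N : ℕ} (α β : Module.Dual ℝ (truncSpace ω N)) {w : List A}
    (hw : wordWeight ω w ≤ N) :
    truncConv α β (truncWord w hw) = wordConv (truncValues α) (truncValues β) w := by
  rw [truncConv_truncWord, wordConv]
  refine Finset.sum_congr rfl fun i _ => ?_
  rw [truncValues_of_le, truncValues_of_le]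

/-- Functionals on the truncated tensors which agree on words are equal. -/
theorem truncDual_ext {N : ℕ} {α β : Module.Dual ℝ (truncSpace ω N)}
    (h : ∀ w (hw : wordWeight ω w ≤ N), α (truncWord w hw) = β (truncWord w hw)) : α = β := by
  refine LinearMap.ext fun x => ?_
  rw [← linExt_truncValues α x, ← linExt_truncValues β x]
  rw [linExt, linExt, Finsupp.linearCombination_apply, Finsupp.linearCombination_apply]
  refine Finsupp.sum_congr fun w hw => ?_
  rw [truncValues_of_le _ (x.2 hw), truncValues_of_le _ (x.2 hw), h]

/-- Chen's identity forces a rough path to be trivial on the diagonal. -/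
theorem eq_zero_of_wordConv_self {n : ℕ} {g : List A → ℝ}
    (hg : g [] = 1) (h : ∀ w, wordWeight ω w ≤ n → wordConv g g w = g w) (w : List A)
    (hw : wordWeight ω w ≤ n) (hw0 : w ≠ []) : g w = 0 := by
  induction hk : w.length using Nat.strong_induction_on generalizing w with
  | _ k ih =>
  subst hk
  obtain ⟨a, w, rfl⟩ := List.exists_cons_of_ne_nil hw0
  have h1 := h _ hw
  rw [wordConv, List.length_cons, Finset.sum_range_succ, Finset.sum_range_succ',
    Finset.sum_eq_zero fun i hi => ?_] at h1
  · rw [List.take_zero, List.drop_zero, List.take_of_length_le (by simp),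
      List.drop_of_length_le (by simp), hg] at h1
    linarith
  · have hi' := Finset.mem_range.1 hi
    rw [ih ((a :: w).take (i + 1)).length (by simp; omega) _
      ((wordWeight_take_le ω _ _).trans hw) (by simp) rfl, zero_mul]

/-- A functional which is multiplicative at words is multiplicative. -/
theorem apply_quasiShuffle {α : Module.Dual ℝ (Tensor A)}
    (h : ∀ u v, α (quasiShuffle B (word u) (word v)) = α (word u) * α (word v)) (x y : Tensor A) :
    α (quasiShuffle B x y) = α x * α y := by
  have e : (quasiShuffle B).compr₂ α = (LinearMap.mul ℝ ℝ).compl₁₂ α α :=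
    Finsupp.lhom_ext' fun u => LinearMap.ext_ring (Finsupp.lhom_ext' fun v =>
      LinearMap.ext_ring (h u v))
  exact congrArg (fun F : Tensor A →ₗ[ℝ] Tensor A →ₗ[ℝ] ℝ => F x y) e

theorem IsQuasiGeometricRoughPath.isPartialRoughPath (hω : IsIntrinsicWeight B ω)
    {X : Set.Icc 0 T → Set.Icc 0 T → Module.Dual ℝ (truncSpace ω (level γ))}
    (hX : IsQuasiGeometricRoughPath B ω γ T X) :
    IsPartialRoughPath B ω γ (level γ) (fun s t => truncValues (X s t)) := by
  have hnil : ∀ s t, truncValues (X s t) [] = 1 := fun s t => by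
    rw [truncValues_of_le _ (Nat.zero_le _)]
    exact hX.unit s t
  have hchen : ∀ s u t w, wordWeight ω w ≤ level γ →
      wordConv (truncValues (X s u)) (truncValues (X u t)) w = truncValues (X s t) w :=
    fun s u t w hw => by rw [← truncConv_apply _ _ hw, hX.chen, truncValues_of_le _ hw]
  refine ⟨fun s t => ⟨hnil s t, fun u v huv => ?_⟩, hchen, fun w hw => ?_⟩
  · have hu : wordWeight ω u ≤ level γ := by omega
    have hv : wordWeight ω v ≤ level γ := by omega
    rw [truncValues_of_le _ hu, truncValues_of_le _ hv]
    exact (linExt_truncValues (X s t) ⟨_, quasiShuffle_mem_truncSpace hω huv⟩).trans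
      (hX.mul s t (truncWord u hu) (truncWord v hv) (quasiShuffle_mem_truncSpace hω huv))
  · by_cases hw0 : w = []
    · subst hw0
      exact ⟨1, zero_le_one, fun s t => by simp [hnil, wordWeight_nil]⟩
    · refine HolderBound.of_ne (fun s => eq_zero_of_wordConv_self (hnil s s)
        (hchen s s s) w hw hw0) ?_
      simp only [truncValues_of_le _ hw]
      exact hX.holder w hw

/-- A family which is a partial rough path for all large weights consists of characters of the
whole algebra and satisfies Chen's identity there. -/
theorem isLyonsExtension_linExt {N : ℕ} {XX : Set.Icc 0 T → Set.Icc 0 T → List A → ℝ}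
    (hXX : ∀ n ≥ N, IsPartialRoughPath B ω γ n XX) :
    IsLyonsExtension B ω γ T (fun s t => linExt (XX s t) ∘ₗ (truncSpace ω (level γ)).subtype)
      (fun s t => linExt (XX s t)) where
  extends_ _ _ := rfl
  mul s t := apply_quasiShuffle fun u v => by
    rw [linExt_word, linExt_word]
    exact ((hXX (N + (wordWeight ω u + wordWeight ω v)) (by omega)).char s t).mul u v (by omega)
  chen s u t := by
    rw [conv_linExt]
    refine Finsupp.lhom_ext' fun w => LinearMap.ext_ring ?_
    change linExt _ (word w) = linExt _ (word w)
    rw [linExt_word, linExt_word]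
    exact (hXX (N + wordWeight ω w) (by omega)).chen s u t w (by omega)
  holder w := by
    obtain ⟨C, -, hC⟩ := (hXX (N + wordWeight ω w) (by omega)).holder w (by omega)
    exact ⟨C, fun s t _ => by rw [linExt_word]; exact hC s t⟩

theorem one_lt_mul_of_level_lt (hγ : 0 < γ) {k : ℕ} (hk : level γ < k) : 1 < γ * k := by
  have h := Nat.lt_of_floor_lt hk
  rwa [inv_eq_one_div, div_lt_iff₀' hγ] at h

/-- The difference of two Lyons extensions at a word of minimal weight is additive and of order
larger than one. -/
theorem IsLyonsExtension.unique (hω : IsIntrinsicWeight B ω) (hγ : 0 < γ)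
    {X : Set.Icc 0 T → Set.Icc 0 T → Module.Dual ℝ (truncSpace ω (level γ))}
    (hX : IsQuasiGeometricRoughPath B ω γ T X)
    {Y Z : Set.Icc 0 T → Set.Icc 0 T → Module.Dual ℝ (Tensor A)}
    (hY : IsLyonsExtension B ω γ T X Y) (hZ : IsLyonsExtension B ω γ T X Z) : Y = Z := by
  have hlow : ∀ {Y : Set.Icc 0 T → Set.Icc 0 T → Module.Dual ℝ (Tensor A)},
      IsLyonsExtension B ω γ T X Y → ∀ w (hw : wordWeight ω w ≤ level γ), ∀ s t,
        Y s t (word w) = X s t (truncWord w hw) := fun hY w hw s t => by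
    rw [← hY.extends_ s t]
    rfl
  have hnil : ∀ {Y : Set.Icc 0 T → Set.Icc 0 T → Module.Dual ℝ (Tensor A)},
      IsLyonsExtension B ω γ T X Y → ∀ s t, Y s t (word []) = 1 := fun hY s t => by
    rw [hlow hY [] (Nat.zero_le _), hX.unit]
  have key : ∀ w s t, Y s t (word w) = Z s t (word w) := by
    intro w
    induction hk : wordWeight ω w using Nat.strong_induction_on generalizing w with
    | _ k ih =>
    subst hk
    intro s t
    rcases Nat.lt_or_ge (level γ) (wordWeight ω w) with h | h
    swap
    · rw [hlow hY w h, hlow hZ w h]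
    have hw0 : w ≠ [] := by
      rintro rfl
      rw [wordWeight_nil] at h
      omega
    have hchen : ∀ {Y : Set.Icc 0 T → Set.Icc 0 T → Module.Dual ℝ (Tensor A)},
        IsLyonsExtension B ω γ T X Y → ∀ s u t, Y s t (word w) =
          wordConv (fun v => Y s u (word v)) (fun v => Y u t (word v)) w := fun hY s u t => by
      rw [← hY.chen s u t, conv_word, wordConv]
    obtain ⟨C, hC⟩ := hY.holder w
    obtain ⟨C', hC'⟩ := hZ.holder w
    refine sub_eq_zero.1 (eq_zero_of_additive (G := fun s t => Y s t (word w) - Z s t (word w))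
      (C := C + C') (one_lt_mul_of_level_lt hγ h) (fun s u t => ?_) (fun s t hst => ?_) s t)
    · rw [hchen hY s u t, hchen hZ s u t,
        wordConv_perturb_left hω (hnil hY u t) (f := fun v => Z s u (word v))
          (fun v hv => ih _ hv v rfl s u),
        wordConv_perturb_right hω (hnil hZ s u) hw0 (g := fun v => Z u t (word v))
          (fun v hv => ih _ hv v rfl u t)]
      ring
    · rw [add_mul]
      exact (abs_sub _ _).trans (add_le_add (hC s t hst) (hC' s t hst))
  funext s t
  exact Finsupp.lhom_ext' fun w => LinearMap.ext_ring (key w s t)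

theorem isPartialRoughPath_zero (hω : IsIntrinsicWeight B ω) :
    IsPartialRoughPath (T := T) B ω γ 0 (fun _ _ w => if w = [] then 1 else 0) := by
  have h0 : ∀ w : List A, wordWeight ω w ≤ 0 → w = [] := fun w hw => by
    by_contra h
    have := wordWeight_pos hω h
    omega
  refine ⟨fun s t => ⟨if_pos rfl, fun u v huv => ?_⟩, fun s u t w hw => ?_, fun w hw => ?_⟩
  · rw [h0 u (by omega), h0 v (by omega), quasiShuffle_nil_left, linExt_word]
    simp
  · rw [h0 w hw, wordConv_nil]
    simp
  · rw [h0 w hw]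
    exact ⟨1, zero_le_one, fun s t => by simp [wordWeight_nil]⟩

end Truncated

end QuasiGeom

end

theorem mainTheorem5 {A : Type*} [Finite A] (B : CommBracket A) (ω : A → ℕ)
    (hω : IsIntrinsicWeight B ω) (γ : ℝ) (hγ0 : 0 < γ) (hγ1 : γ < 1) (T : ℝ) (hT : 0 < T) :
    (∀ X : Set.Icc 0 T → Set.Icc 0 T → Module.Dual ℝ (truncSpace ω (level γ)),
      IsQuasiGeometricRoughPath B ω γ T X →
        ∃! XX : Set.Icc 0 T → Set.Icc 0 T → Module.Dual ℝ (Tensor A),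
          IsLyonsExtension B ω γ T X XX) ∧
    ((∀ w : List A, γ * (wordWeight ω w : ℝ) ≠ 1) →
      ∀ x : Set.Icc 0 T → A → ℝ,
        (∃ C : ℝ, ∀ a : A, ∀ s t : Set.Icc 0 T, s ≠ t →
          |x t a - x s a| ≤ C * |(t : ℝ) - (s : ℝ)| ^ (γ * (ω a : ℝ))) →
        ∃ X : Set.Icc 0 T → Set.Icc 0 T → Module.Dual ℝ (truncSpace ω (level γ)),
          IsQuasiGeometricRoughPath B ω γ T X ∧ IsOver X x) := by
  refine ⟨fun X hX => ?_, fun hne x hx => ?_⟩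
  · obtain ⟨XX, hXX, hlow, -⟩ := (hX.isPartialRoughPath hω).exists_forall hω hγ0 hT
      (fun w hw => (one_lt_mul_of_level_lt hγ0 hw).ne') (x := 0)
      (fun a => by simpa using HolderBound.zero)
    have hres : (fun s t => linExt (XX s t) ∘ₗ (truncSpace ω (level γ)).subtype) = X := by
      funext s t
      refine truncDual_ext fun w hw => ?_
      rw [← truncValues_of_le (X s t) hw, ← hlow s t w hw, ← linExt_word (XX s t) w]
      rfl
    have hext := isLyonsExtension_linExt hXX
    rw [hres] at hext
    exact ⟨_, hext, fun YY hYY => hYY.unique hω hγ0 hX hext⟩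
  · obtain ⟨C, hC⟩ := hx
    obtain ⟨XX, hXX, -, hletter⟩ := (isPartialRoughPath_zero hω).exists_forall hω hγ0 hT
      (fun w _ => hne w) (x := x)
      (fun a => HolderBound.of_ne (fun s => sub_self _) ⟨C, fun s t => hC a s t⟩)
    have hext := isLyonsExtension_linExt hXX
    refine ⟨fun s t => linExt (XX s t) ∘ₗ (truncSpace ω (level γ)).subtype,
      ⟨fun s t => ?_, fun s t x y _ => hext.mul s t x y, fun s u t => ?_,
      fun w _ => hext.holder w⟩, fun a _ s t => ?_⟩
    · exact (linExt_word (XX s t) []).trans ((hXX 0 le_rfl).char s t).nil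
    · refine truncDual_ext fun w hw => ?_
      rw [truncConv_apply _ _ hw]
      refine (wordConv_congr (ω := ω) (fun v hv => ?_) (fun v hv => ?_)).trans
        (((hXX (wordWeight ω w) (Nat.zero_le _)).chen s u t w le_rfl).trans
          (linExt_word (XX s t) w).symm)
      · rw [truncValues_of_le _ (hv.trans hw)]
        exact linExt_word (XX s u) v
      · rw [truncValues_of_le _ (hv.trans hw)]
        exact linExt_word (XX u t) v
    · exact (linExt_word (XX s t) [a]).trans (hletter a (hω.pos a) s t)
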